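/- For $b,c>0$, let $L^2(\cosh(b\cdot))$ be the Hilbert space of complex-valued functions on $\mathbb{R}$ with inner product $\langle f,g\rangle=\int_{\mathbb{R}} f(t)\overline{g(t)}\cosh(bt)\,dt$, let $L^2(-1,1)$ be the usual space of complex-valued functions, and let $$\mathcal{F}_{b,c}:L^2(\cosh(b\cdot))\to L^2(-1,1),\qquad \mathcal{F}_{b,c}[f](x)=\int_{\mathbb{R}}e^{icxt}f(t)\,dt,$$ with Hilbert space adjoint $\mathcal{F}_{b,c}^*$. For $a>0$ let $\mathcal{Q}_a$ be the operator on $L^2(-1,1)$ given by $$\mathcal{Q}_a[h](x)=\int_{-1}^{1}\pi a\,\mathrm{sech}\!\left(\frac{\pi a}{2}(x-y)\right)h(y)\,dy .$$ Then, for all $b,c>0$: 1. $\mathcal{F}_{b,c}$ is injective. 2. The positive eigenvalues of $\mathcal{Q}_{c/b}$ can be listed in decreasing order, repeated according to multiplicity, as an infinite sequence $(\rho_m)_{m\in\mathbb{N}_0}$, with an orthonormal sequence $(g_m)_{m\in\mathbb{N}_0}$ of associated eigenfunctions, $\mathcal{Q}_{c/b}\,g_m=\rho_m g_m$. 3. For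 every such choice of $(\rho_m)$ and $(g_m)$, put $\sigma_m=\sqrt{\rho_m/c}$ and $\varphi_m=\mathcal{F}_{b,c}^*g_m/\sigma_m$. Then $\mathcal{F}_{b,c}\,\varphi_m=\sigma_m g_m$ for all $m\in\mathbb{N}_0$, so that the $\varphi_m$ are singular vectors of $\mathcal{F}_{b,c}$, and $(\varphi_m)_{m\in\mathbb{N}_0}$ is an orthonormal (Hilbert) basis of $L^2(\cosh(b\cdot))$. -/

import Mathlib

open MeasureTheory

noncomputable section

namespace WeightedFourier

/-- The measure `cosh(b t) dt` on the real line. -/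
def coshMeasure (b : ℝ) : Measure ℝ :=
  volume.withDensity fun t => ENNReal.ofReal (Real.cosh (b * t))

/-- The weighted space `L²(cosh(b·))` of complex-valued functions on the real line, with inner
product `∫ f(t) conj(g(t)) cosh(b t) dt`. -/
abbrev L2Cosh (b : ℝ) : Type := Lp ℂ 2 (coshMeasure b)

/-- Lebesgue measure on the interval `(-1, 1)`. -/
abbrev intervalMeasure : Measure ℝ := volume.restrict (Set.Ioo (-1 : ℝ) 1)

/-- The space `L²(-1, 1)` of complex-valued functions. -/
abbrev L2Interval : Type := Lp ℂ 2 intervalMeasure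

/-- The hyperbolic secant. -/
def sech (x : ℝ) : ℝ := 1 / Real.cosh x

theorem sech_pos (x : ℝ) : 0 < sech x := by
  unfold sech; exact div_pos one_pos (Real.cosh_pos x)

theorem sech_le_one (x : ℝ) : sech x ≤ 1 := by
  unfold sech; exact (div_le_one (Real.cosh_pos x)).2 (Real.one_le_cosh x)

theorem continuous_sech : Continuous sech := by
  unfold sech
  exact continuous_const.div Real.continuous_cosh fun x => (Real.cosh_pos x).ne'

theorem sech_le (x : ℝ) : sech x ≤ 4 * (1 + x ^ 2)⁻¹ := by
  have h1 := Real.quadratic_le_exp_of_nonneg (abs_nonneg x)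
  have h2 := Real.add_one_le_exp (-|x|)
  unfold sech
  rw [← div_eq_mul_inv, div_le_div_iff₀ (Real.cosh_pos x) (by positivity), ← Real.cosh_abs,
    Real.cosh_eq]
  rw [sq_abs] at h1
  nlinarith [sq_nonneg x]

theorem integrable_sech_mul {b : ℝ} (hb : 0 < b) : Integrable fun t : ℝ => sech (b * t) := by
  have h0 : Integrable fun t : ℝ => 4 * (1 + (b * t) ^ 2)⁻¹ :=
    (integrable_inv_one_add_sq.comp_mul_left' hb.ne').const_mul 4
  refine h0.mono' (continuous_sech.comp (by fun_prop)).aestronglyMeasurable ?_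
  filter_upwards with t
  rw [Real.norm_of_nonneg (sech_pos _).le]
  exact sech_le (b * t)

theorem measurable_coshDensity (b : ℝ) :
    Measurable fun t : ℝ => (Real.cosh (b * t)).toNNReal := by
  have : Continuous fun t : ℝ => Real.cosh (b * t) := by fun_prop
  exact this.measurable.real_toNNReal

theorem coshMeasure_eq (b : ℝ) :
    coshMeasure b = volume.withDensity fun t => (((Real.cosh (b * t)).toNNReal : NNReal) : ENNReal) :=
  rfl

theorem integrable_coshMeasure_iff {E : Type*} [NormedAddCommGroup E] [NormedSpace ℝ E] (b : ℝ)
    {u : ℝ → E} :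
    Integrable u (coshMeasure b) ↔ Integrable (fun t => Real.cosh (b * t) • u t) volume := by
  rw [coshMeasure_eq, integrable_withDensity_iff_integrable_smul (measurable_coshDensity b)]
  simp only [NNReal.smul_def, Real.coe_toNNReal _ (Real.cosh_pos _).le]

theorem integral_coshMeasure (b : ℝ) (u : ℝ → ℝ) :
    ∫ t, u t ∂(coshMeasure b) = ∫ t, Real.cosh (b * t) * u t := by
  rw [coshMeasure_eq, integral_withDensity_eq_integral_smul (measurable_coshDensity b)]
  simp only [NNReal.smul_def, Real.coe_toNNReal _ (Real.cosh_pos _).le, smul_eq_mul]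

/-- The weighted measure and Lebesgue measure have the same null sets. -/
theorem volume_absolutelyContinuous (b : ℝ) : volume ≪ coshMeasure b := by
  rw [coshMeasure_eq]
  refine withDensity_absolutelyContinuous' (measurable_coshDensity b).coe_nnreal_ennreal.aemeasurable ?_
  filter_upwards with t
  simp [Real.cosh_pos]

theorem memLp_sech {b : ℝ} (hb : 0 < b) :
    MemLp (fun t : ℝ => ((sech (b * t) : ℝ) : ℂ)) 2 (coshMeasure b) := by
  have hc : Continuous fun t : ℝ => ((sech (b * t) : ℝ) : ℂ) :=
    Complex.continuous_ofReal.comp (continuous_sech.comp (by fun_prop))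
  rw [memLp_two_iff_integrable_sq_norm hc.aestronglyMeasurable, integrable_coshMeasure_iff]
  refine (integrable_sech_mul hb).congr ?_
  filter_upwards with t
  rw [Complex.norm_real,
    Real.norm_of_nonneg (sech_pos _).le, smul_eq_mul]
  have := (Real.cosh_pos (b * t)).ne'
  unfold sech
  field_simp

theorem memLp_sech_smul {b : ℝ} (hb : 0 < b) (f : L2Cosh b) :
    MemLp ((fun t : ℝ => ((sech (b * t) : ℝ) : ℂ)) • (f : ℝ → ℂ)) 1 (coshMeasure b) :=
  (Lp.memLp f).smul (memLp_sech hb)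

/-- Elements of `L²(cosh(b·))` with `b > 0` are Lebesgue integrable. -/
theorem integrable_of_L2Cosh {b : ℝ} (hb : 0 < b) (f : L2Cosh b) :
    Integrable (f : ℝ → ℂ) volume := by
  have h := memLp_one_iff_integrable.1 (memLp_sech_smul hb f)
  rw [integrable_coshMeasure_iff] at h
  refine h.congr ?_
  filter_upwards with t
  rw [Pi.smul_apply', smul_eq_mul,
    Complex.real_smul, ← mul_assoc, ← Complex.ofReal_mul]
  have := (Real.cosh_pos (b * t)).ne'
  have h1 : Real.cosh (b * t) * sech (b * t) = 1 := by unfold sech; field_simp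
  rw [h1]; simp

theorem integral_norm_le {b : ℝ} (hb : 0 < b) (f : L2Cosh b) :
    ∫ t, ‖f t‖ ≤
      (eLpNorm (fun t : ℝ => ((sech (b * t) : ℝ) : ℂ)) 2 (coshMeasure b)).toReal * ‖f‖ := by
  have h2 := eLpNorm_smul_le_mul_eLpNorm (p := 2) (q := 2) (r := 1)
    (Lp.memLp f).1 (memLp_sech hb).1
  have h3 : ∫ t, ‖f t‖ =
      ∫ t, ‖((fun t : ℝ => ((sech (b * t) : ℝ) : ℂ)) • (f : ℝ → ℂ)) t‖ ∂(coshMeasure b) := by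
    rw [integral_coshMeasure]
    congr 1
    funext t
    rw [Pi.smul_apply', smul_eq_mul, norm_mul, Complex.norm_real, Real.norm_of_nonneg (sech_pos _).le, ← mul_assoc]
    have := (Real.cosh_pos (b * t)).ne'
    have h1 : Real.cosh (b * t) * sech (b * t) = 1 := by unfold sech; field_simp
    rw [h1, one_mul]
  rw [h3, integral_norm_eq_lintegral_enorm (memLp_sech_smul hb f).1,
    ← eLpNorm_one_eq_lintegral_enorm, Lp.norm_def, ← ENNReal.toReal_mul]
  exact ENNReal.toReal_mono (ENNReal.mul_ne_top (memLp_sech hb).2.ne (Lp.memLp f).2.ne) h2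

/-- The function `x ↦ ∫ k(x, t) f(t) dμ(t)`. -/
def kernelIntegral (μ : Measure ℝ) (k : ℝ → ℝ → ℂ) (f : ℝ → ℂ) (x : ℝ) : ℂ := ∫ t, k x t * f t ∂μ

section Kernel

variable {μ : Measure ℝ} {k : ℝ → ℝ → ℂ} {M : ℝ} {f : ℝ → ℂ}

theorem integrable_kernel (hk : Continuous (Function.uncurry k)) (hM : ∀ x t, ‖k x t‖ ≤ M)
    (hf : Integrable f μ) (x : ℝ) : Integrable (fun t => k x t * f t) μ :=
  hf.bdd_mul (c := M) (hk.uncurry_left x).aestronglyMeasurable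
    (Filter.Eventually.of_forall fun t => hM x t)

theorem norm_kernelIntegral_le (hM : ∀ x t, ‖k x t‖ ≤ M)
    (hf : Integrable f μ) (x : ℝ) : ‖kernelIntegral μ k f x‖ ≤ M * ∫ t, ‖f t‖ ∂μ := by
  rw [← integral_const_mul]
  refine norm_integral_le_of_norm_le (hf.norm.const_mul M) (Filter.Eventually.of_forall fun t => ?_)
  rw [norm_mul]
  exact mul_le_mul_of_nonneg_right (hM x t) (norm_nonneg _)

theorem continuous_kernelIntegral (hk : Continuous (Function.uncurry k))
    (hM : ∀ x t, ‖k x t‖ ≤ M) (hf : Integrable f μ) : Continuous (kernelIntegral μ k f) := by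
  refine continuous_of_dominated (bound := fun t => M * ‖f t‖)
    (fun x => (integrable_kernel hk hM hf x).1) (fun x => Filter.Eventually.of_forall fun t => ?_)
    (hf.norm.const_mul M) (Filter.Eventually.of_forall fun t => ?_)
  · rw [norm_mul]
    exact mul_le_mul_of_nonneg_right (hM x t) (norm_nonneg _)
  · exact (hk.uncurry_right t).mul continuous_const

theorem memLp_kernelIntegral (hk : Continuous (Function.uncurry k))
    (hM : ∀ x t, ‖k x t‖ ≤ M) (hf : Integrable f μ) :
    MemLp (kernelIntegral μ k f) 2 intervalMeasure :=
  MemLp.of_bound (continuous_kernelIntegral hk hM hf).aestronglyMeasurable _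
    (Filter.Eventually.of_forall fun x => norm_kernelIntegral_le hM hf x)

theorem norm_toLp_kernelIntegral_le (hk : Continuous (Function.uncurry k))
    (hM : ∀ x t, ‖k x t‖ ≤ M) (hf : Integrable f μ) :
    ‖(memLp_kernelIntegral hk hM hf).toLp (kernelIntegral μ k f)‖ ≤
      (intervalMeasure.real Set.univ) ^ (2 : ENNReal).toReal⁻¹ * (M * ∫ t, ‖f t‖ ∂μ) := by
  have hM0 : 0 ≤ M := (norm_nonneg _).trans (hM 0 0)
  refine Lp.norm_le_of_ae_bound (mul_nonneg hM0 (integral_nonneg fun t => norm_nonneg _)) ?_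
  filter_upwards [(memLp_kernelIntegral hk hM hf).coeFn_toLp] with x hx
  rw [hx]
  exact norm_kernelIntegral_le hM hf x

end Kernel

/-- The kernel `e^{i c x t}`. -/
def fourierKernel (c : ℝ) (x t : ℝ) : ℂ := Complex.exp (Complex.I * ((c * x * t : ℝ) : ℂ))

theorem continuous_fourierKernel (c : ℝ) : Continuous (Function.uncurry (fourierKernel c)) := by
  unfold fourierKernel Function.uncurry
  fun_prop

theorem norm_fourierKernel_le (c x t : ℝ) : ‖fourierKernel c x t‖ ≤ 1 := by
  unfold fourierKernel
  rw [Complex.norm_exp_I_mul_ofReal]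

/-- The truncated Fourier transform `𝓕_{b,c} : L²(cosh(b·)) → L²(-1, 1)`,
`(𝓕_{b,c} f)(x) = ∫ e^{i c x t} f(t) dt`. -/
def truncatedFourier (b c : ℝ) (hb : 0 < b) : L2Cosh b →L[ℂ] L2Interval :=
  LinearMap.mkContinuous
    { toFun := fun f =>
        (memLp_kernelIntegral (continuous_fourierKernel c) (norm_fourierKernel_le c)
          (integrable_of_L2Cosh hb f)).toLp (kernelIntegral volume (fourierKernel c) f)
      map_add' := by
        intro f g
        rw [← MemLp.toLp_add]
        congr 1
        funext x
        have hf := integrable_kernel (continuous_fourierKernel c) (norm_fourierKernel_le c)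
          (integrable_of_L2Cosh hb f) x
        have hg := integrable_kernel (continuous_fourierKernel c) (norm_fourierKernel_le c)
          (integrable_of_L2Cosh hb g) x
        simp only [kernelIntegral, Pi.add_apply]
        rw [← integral_add hf hg]
        refine integral_congr_ae ?_
        filter_upwards [(volume_absolutelyContinuous b).ae_le (Lp.coeFn_add f g)] with t ht
        rw [ht, Pi.add_apply, mul_add]
      map_smul' := by
        intro a f
        rw [RingHom.id_apply, ← MemLp.toLp_const_smul]
        congr 1
        funext x
        simp only [kernelIntegral, Pi.smul_apply, smul_eq_mul]
        rw [← integral_const_mul]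
        refine integral_congr_ae ?_
        filter_upwards [(volume_absolutelyContinuous b).ae_le (Lp.coeFn_smul a f)] with t ht
        rw [ht, Pi.smul_apply, smul_eq_mul, mul_left_comm] }
    ((intervalMeasure.real Set.univ) ^ (2 : ENNReal).toReal⁻¹ *
      (1 * (eLpNorm (fun t : ℝ => ((sech (b * t) : ℝ) : ℂ)) 2 (coshMeasure b)).toReal))
    (by
      intro f
      refine (norm_toLp_kernelIntegral_le (continuous_fourierKernel c) (norm_fourierKernel_le c)
        (integrable_of_L2Cosh hb f)).trans ?_
      rw [mul_assoc, one_mul, one_mul]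
      exact mul_le_mul_of_nonneg_left (integral_norm_le hb f)
        (Real.rpow_nonneg measureReal_nonneg _))

/-- The kernel `π c sech((π c / 2) (x - y))`. -/
def convolutionKernel (c : ℝ) (x y : ℝ) : ℂ :=
  ((Real.pi * c * sech (Real.pi * c / 2 * (x - y)) : ℝ) : ℂ)

theorem continuous_convolutionKernel (c : ℝ) :
    Continuous (Function.uncurry (convolutionKernel c)) := by
  unfold convolutionKernel Function.uncurry
  exact Complex.continuous_ofReal.comp
    (continuous_const.mul (continuous_sech.comp (by fun_prop)))

theorem norm_convolutionKernel_le (c x y : ℝ) : ‖convolutionKernel c x y‖ ≤ |Real.pi * c| := by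
  unfold convolutionKernel
  rw [Complex.norm_real, norm_mul, Real.norm_eq_abs, Real.norm_of_nonneg (sech_pos _).le]
  exact mul_le_of_le_one_right (abs_nonneg _) (sech_le_one _)

theorem integrable_of_L2Interval (h : L2Interval) : Integrable (h : ℝ → ℂ) intervalMeasure :=
  (Lp.memLp h).integrable one_le_two

theorem integral_norm_le_L2Interval (h : L2Interval) :
    ∫ t, ‖h t‖ ∂intervalMeasure ≤ (intervalMeasure Set.univ ^ (1 / 2 : ℝ)).toReal * ‖h‖ := by
  have h1 := eLpNorm_le_eLpNorm_mul_rpow_measure_univ (μ := intervalMeasure) (p := 1) (q := 2)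
    one_le_two (Lp.memLp h).1
  have h2 : 1 / (1 : ENNReal).toReal - 1 / (2 : ENNReal).toReal = 1 / 2 := by norm_num
  rw [h2] at h1
  rw [integral_norm_eq_lintegral_enorm (Lp.memLp h).1, ← eLpNorm_one_eq_lintegral_enorm,
    Lp.norm_def, ← ENNReal.toReal_mul, mul_comm]
  exact ENNReal.toReal_mono (ENNReal.mul_ne_top (Lp.memLp h).2.ne
    (ENNReal.rpow_ne_top_of_nonneg (by norm_num) (measure_ne_top _ _))) h1

/-- The finite convolution operator `𝓠_c` on `L²(-1, 1)`,
`(𝓠_c h)(x) = ∫_{-1}^{1} π c sech((π c / 2) (x - y)) h(y) dy`. -/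
def finiteConvolution (c : ℝ) : L2Interval →L[ℂ] L2Interval :=
  LinearMap.mkContinuous
    { toFun := fun h =>
        (memLp_kernelIntegral (continuous_convolutionKernel c) (norm_convolutionKernel_le c)
          (integrable_of_L2Interval h)).toLp (kernelIntegral intervalMeasure (convolutionKernel c) h)
      map_add' := by
        intro f g
        rw [← MemLp.toLp_add]
        congr 1
        funext x
        have hf := integrable_kernel (continuous_convolutionKernel c) (norm_convolutionKernel_le c)
          (integrable_of_L2Interval f) x
        have hg := integrable_kernel (continuous_convolutionKernel c) (norm_convolutionKernel_le c)
          (integrable_of_L2Interval g) x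
        simp only [kernelIntegral, Pi.add_apply]
        rw [← integral_add hf hg]
        refine integral_congr_ae ?_
        filter_upwards [Lp.coeFn_add f g] with t ht
        rw [ht, Pi.add_apply, mul_add]
      map_smul' := by
        intro a f
        rw [RingHom.id_apply, ← MemLp.toLp_const_smul]
        congr 1
        funext x
        simp only [kernelIntegral, Pi.smul_apply, smul_eq_mul]
        rw [← integral_const_mul]
        refine integral_congr_ae ?_
        filter_upwards [Lp.coeFn_smul a f] with t ht
        rw [ht, Pi.smul_apply, smul_eq_mul, mul_left_comm] }
    ((intervalMeasure.real Set.univ) ^ (2 : ENNReal).toReal⁻¹ *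
      (|Real.pi * c| * (intervalMeasure Set.univ ^ (1 / 2 : ℝ)).toReal))
    (by
      intro h
      refine (norm_toLp_kernelIntegral_le (continuous_convolutionKernel c)
        (norm_convolutionKernel_le c) (integrable_of_L2Interval h)).trans ?_
      rw [mul_assoc, mul_assoc]
      exact mul_le_mul_of_nonneg_left
        (mul_le_mul_of_nonneg_left (integral_norm_le_L2Interval h) (abs_nonneg _))
        (Real.rpow_nonneg measureReal_nonneg _))

/-- `ρ` lists the positive eigenvalues of `𝓠_c` in decreasing order, repeated according to
multiplicity, and `g` is an orthonormal sequence of associated eigenfunctions. -/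
structure IsEigensystem (c : ℝ) (ρ : ℕ → ℝ) (g : ℕ → L2Interval) : Prop where
  pos : ∀ m, 0 < ρ m
  antitone : Antitone ρ
  multiplicity : ∀ r : ℝ, 0 < r →
    Cardinal.mk {m : ℕ // ρ m = r} =
      Module.rank ℂ (Module.End.eigenspace (finiteConvolution c : L2Interval →ₗ[ℂ] L2Interval) (r : ℂ))
  orthonormal : Orthonormal ℂ g
  eigen : ∀ m, finiteConvolution c (g m) = (ρ m : ℂ) • g m

/-- The singular values `σ_m = √(ρ_m / c)` of the truncated Fourier transform. -/
def singularValue (c : ℝ) (ρ : ℕ → ℝ) (m : ℕ) : ℝ := Real.sqrt (ρ m / c)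

/-- The singular vectors `φ_m = 𝓕_{b,c}^* g_m / σ_m` in `L²(cosh(b·))`, where the star is the
Hilbert space adjoint for the weighted inner product. -/
def singularVector (b c : ℝ) (hb : 0 < b) (ρ : ℕ → ℝ) (g : ℕ → L2Interval) (m : ℕ) : L2Cosh b :=
  ((singularValue c ρ m : ℂ)⁻¹) • ContinuousLinearMap.adjoint (truncatedFourier b c hb) (g m)

end WeightedFourier

end

/-! ### Spectral theory of compact, symmetric, nonnegative operators. -/

noncomputable section

open Module.End Filter Topology
open scoped InnerProductSpace

/-! Write F for the truncated Fourier transform and Q for the convolution operator with parameter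
c/b. Everything rests on c F F* = Q (`finiteConvolution_eq`): the weight puts a factor sech(bt) into
F*, so the kernel of F F* is the Fourier transform of sech(bt) at c(x - y), which is again a sech
(`integral_exp_mul_sech`). Hence Q is symmetric and nonnegative; it is compact as a norm limit of
finite-rank operators, so its positive eigenvalues can be enumerated.

F is injective (`injective_truncatedFourier`): the weight forces exponential decay, so the transform
of f is analytic in a strip and cannot vanish on an interval unless f = 0. Consequently F* has dense
range in an infinite-dimensional space, so Q has infinite rank and the enumeration is an infinite
sequence.

Orthonormality of the φ_m is algebra from the identity. For completeness, if f is orthogonal to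
every φ_m, then F f is orthogonal to every g_m, so Q F f = 0. This gives F* F f = 0, hence F f = 0
and f = 0. -/

theorem exists_orderIso_nat_of_finite_Iic {ι : Type*} [LinearOrder ι] [Infinite ι]
    (h : ∀ i : ι, (Set.Iic i).Finite) : Nonempty (ℕ ≃o ι) := by
  obtain ⟨i₀⟩ : Nonempty ι := inferInstance
  obtain ⟨b, hb, hmin⟩ := (h i₀).exists_minimal ⟨i₀, le_refl i₀⟩
  let _ : OrderBot ι :=
    { bot := b
      bot_le := fun a => by
        rcases le_total b a with h1 | h1
        · exact h1
        · exact hmin (h1.trans hb) h1 }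
  -- A maximum would make the whole infinite type a finite initial segment.
  have : NoMaxOrder ι := ⟨fun a => by
    by_contra! hcon
    exact Set.infinite_univ ((h a).subset fun x _ => hcon x)⟩
  let _ : LocallyFiniteOrder ι :=
    LocallyFiniteOrder.ofFiniteIcc fun a c => (h c).subset Set.Icc_subset_Iic_self
  let _ : SuccOrder ι := LinearLocallyFiniteOrder.succOrder ι
  let _ : PredOrder ι := LinearLocallyFiniteOrder.predOrder ι
  exact ⟨orderIsoNatOfLinearSuccPredArch.symm⟩

namespace CompactSpectral

variable {E : Type*} [NormedAddCommGroup E] [InnerProductSpace ℂ E] {T : E →L[ℂ] E}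

theorem inner_eq_zero_of_eigenspace_ne (hT' : T.IsSymmetric) {r s : ℝ} (hrs : r ≠ s) {v w : E}
    (hv : v ∈ eigenspace (T : E →ₗ[ℂ] E) (r : ℂ)) (hw : w ∈ eigenspace (T : E →ₗ[ℂ] E) (s : ℂ)) :
    ⟪v, w⟫_ℂ = 0 :=
  LinearMap.IsSymmetric.orthogonalFamily_eigenspaces hT'
    (i := (r : ℂ)) (j := (s : ℂ)) (by exact_mod_cast hrs) ⟨v, hv⟩ ⟨w, hw⟩

/-- The eigenspaces have dense span, so it suffices that T x is orthogonal to each of them. For an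
eigenvector v with eigenvalue μ, symmetry gives ⟪v, T x⟫ = μ ⟪v, x⟫ with μ ≥ 0: it vanishes by
hypothesis if μ > 0 and trivially if μ = 0. -/
theorem apply_eq_zero_of_orthogonal [CompleteSpace E] (hT : IsCompactOperator T)
    (hT' : T.IsSymmetric) (hnn : ∀ x, 0 ≤ RCLike.re ⟪x, T x⟫_ℂ) {x : E}
    (hx : ∀ r : ℝ, 0 < r → ∀ v ∈ eigenspace (T : E →ₗ[ℂ] E) (r : ℂ), ⟪v, x⟫_ℂ = 0) :
    T x = 0 := by
  rw [← Submodule.mem_bot ℂ,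
    ← ContinuousLinearMap.orthogonalComplement_iSup_eigenspaces_eq_bot hT hT',
    ← Submodule.iInf_orthogonal, Submodule.mem_iInf]
  intro μ
  rw [Submodule.mem_orthogonal]
  intro v hv
  by_cases hv0 : v = 0
  · simp [hv0]
  have hμ : HasEigenvalue (T : E →ₗ[ℂ] E) μ :=
    hasEigenvalue_of_hasEigenvector ⟨hv, hv0⟩
  have hreal : ((μ.re : ℝ) : ℂ) = μ := Complex.conj_eq_iff_re.1 (LinearMap.IsSymmetric.conj_eigenvalue_eq_self hT' hμ)
  have hv' : T v = μ • v := mem_eigenspace_iff.1 hv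
  have h0 : 0 ≤ μ.re := eigenvalue_nonneg_of_nonneg (T := (T : E →ₗ[ℂ] E)) (by
    rw [← hreal] at hμ
    exact hμ) hnn
  have hsym : ⟪v, T x⟫_ℂ = ⟪T v, x⟫_ℂ := (hT' v x).symm
  rw [hsym, hv', inner_smul_left]
  rcases h0.eq_or_lt with h | h
  · rw [← hreal, ← h]; simp
  · rw [hx μ.re h v (by rw [hreal]; exact hv), mul_zero]

/-- Unit eigenvectors for distinct eigenvalues are orthogonal, so by Pythagoras their images under T
are at distance at least ε. Infinitely many of them would have no convergent subsequence of images,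
against compactness. -/
theorem finite_eigenvalues_ge (hT : IsCompactOperator T) (hT' : T.IsSymmetric) {ε : ℝ}
    (hε : 0 < ε) : {r : ℝ | ε ≤ r ∧ HasEigenvalue (T : E →ₗ[ℂ] E) (r : ℂ)}.Finite := by
  by_contra hinf
  let r := Set.Infinite.natEmbedding _ hinf
  have hex : ∀ n, ∃ v : E, v ∈ eigenspace (T : E →ₗ[ℂ] E) ((r n : ℝ) : ℂ) ∧ ‖v‖ = 1 := by
    intro n
    obtain ⟨v, hv, hv0⟩ := (r n).2.2.exists_hasEigenvector
    refine ⟨((‖v‖ : ℂ)⁻¹) • v, Submodule.smul_mem _ _ hv, ?_⟩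
    rw [norm_smul, norm_inv, Complex.norm_real, norm_norm, inv_mul_cancel₀ (norm_ne_zero_iff.2 hv0)]
  choose v hv hv1 using hex
  obtain ⟨K, hK, hKsub⟩ := IsCompactOperator.image_closedBall_subset_compact (f := (T : E →ₗ[ℂ] E)) hT 1
  obtain ⟨a, -, φ, hφ, hlim⟩ := hK.tendsto_subseq (x := fun n => T (v n)) fun n =>
    hKsub ⟨v n, by simp [hv1], rfl⟩
  have hc := hlim.cauchySeq
  rw [Metric.cauchySeq_iff'] at hc
  obtain ⟨N, hN⟩ := hc ε hε
  have h1 := hN (N + 1) (Nat.le_succ N)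
  have hne : (r (φ (N + 1)) : ℝ) ≠ r (φ N) := fun h =>
    (hφ (Nat.lt_succ_self N)).ne' (r.injective (Subtype.ext h))
  have horth := inner_eq_zero_of_eigenspace_ne hT' hne (hv (φ (N + 1))) (hv (φ N))
  have ht : ∀ n, T (v n) = ((r n : ℝ) : ℂ) • v n := fun n => mem_eigenspace_iff.1 (hv n)
  have hpyth := norm_sub_sq (𝕜 := ℂ) (T (v (φ (N + 1)))) (T (v (φ N)))
  rw [ht, ht, inner_smul_left, inner_smul_right, horth] at hpyth
  simp only [Function.comp_apply, dist_eq_norm, ht] at h1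
  simp only [norm_smul, hv1, Complex.norm_real, mul_one, mul_zero, map_zero, sub_zero,
    Real.norm_eq_abs, sq_abs] at hpyth
  have := (r (φ (N + 1))).2.1
  nlinarith [norm_nonneg (((r (φ (N + 1)) : ℝ) : ℂ) • v (φ (N + 1)) - ((r (φ N) : ℝ) : ℂ) • v (φ N)),
    sq_nonneg ((r (φ N) : ℝ))]

/-- Pairs `(r, k)` with `r` positive and `k` below the multiplicity of `r`, ordered by
decreasing `r`. -/
abbrev PositiveIndex (T : E →L[ℂ] E) : Type :=
  {p : ℝᵒᵈ ×ₗ ℕ // 0 < OrderDual.ofDual (ofLex p).1 ∧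
    (ofLex p).2 < Module.finrank ℂ
      (eigenspace (T : E →ₗ[ℂ] E) ((OrderDual.ofDual (ofLex p).1 : ℝ) : ℂ))}

/-- The eigenvalue of an index. -/
def PositiveIndex.value (p : PositiveIndex T) : ℝ := OrderDual.ofDual (ofLex p.1).1

theorem PositiveIndex.value_antitone : Antitone (PositiveIndex.value (T := T)) := by
  intro p q hpq
  have h : p.1 ≤ q.1 := hpq
  rw [Prod.Lex.le_iff] at h
  unfold PositiveIndex.value
  rcases h with h | ⟨h, -⟩
  · exact (OrderDual.ofDual_lt_ofDual.2 h).le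
  · rw [h]

theorem PositiveIndex.hasEigenvalue (p : PositiveIndex T) :
    HasEigenvalue (T : E →ₗ[ℂ] E) (p.value : ℂ) := by
  intro h
  have := p.2.2
  unfold PositiveIndex.value at h
  change _ < Module.finrank ℂ (eigenspace (T : E →ₗ[ℂ] E) _) at this
  rw [eigenspace, h] at this
  simp at this

/-- Indices before p have eigenvalue at least that of p. There are finitely many such eigenvalues,
and each carries finitely many k. -/
theorem PositiveIndex.finite_Iic (hT : IsCompactOperator T) (hT' : T.IsSymmetric)
    (p : PositiveIndex T) : (Set.Iic p).Finite := by
  have h1 := finite_eigenvalues_ge hT hT' p.2.1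
  have h3 := h1.biUnion (t := fun r : ℝ =>
    (fun k => (toLex (OrderDual.toDual r, k) : ℝᵒᵈ ×ₗ ℕ)) ''
      (Set.Iio (Module.finrank ℂ (eigenspace (T : E →ₗ[ℂ] E) (r : ℂ)))))
      fun r _ => (Set.finite_Iio _).image _
  refine Set.Finite.of_finite_image (h3.subset ?_) Subtype.val_injective.injOn
  rintro _ ⟨q, hq, rfl⟩
  refine Set.mem_biUnion (x := q.value) ⟨value_antitone hq, q.hasEigenvalue⟩ ⟨_, q.2.2, rfl⟩

/-- An orthonormal family of eigenvectors. -/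
def PositiveIndex.vector (T : E →L[ℂ] E) (p : PositiveIndex T) : E :=
  haveI : FiniteDimensional ℂ (eigenspace (T : E →ₗ[ℂ] E) (p.value : ℂ)) :=
    -- `finrank` is 0 in infinite dimension, so an index below it forces the eigenspace to be
    -- finite-dimensional.
    Module.finite_of_finrank_pos (lt_of_le_of_lt (Nat.zero_le _) p.2.2)
  stdOrthonormalBasis ℂ (eigenspace (T : E →ₗ[ℂ] E) (p.value : ℂ)) ⟨(ofLex p.1).2, p.2.2⟩

theorem PositiveIndex.vector_mem (p : PositiveIndex T) :
    p.vector T ∈ eigenspace (T : E →ₗ[ℂ] E) (p.value : ℂ) :=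
  Subtype.property _

theorem PositiveIndex.vector_mk {r : ℝ} (hr : 0 < r)
    [FiniteDimensional ℂ (eigenspace (T : E →ₗ[ℂ] E) (r : ℂ))]
    (k : Fin (Module.finrank ℂ (eigenspace (T : E →ₗ[ℂ] E) (r : ℂ)))) :
    PositiveIndex.vector T ⟨toLex (OrderDual.toDual r, k.1), hr, k.2⟩ =
      stdOrthonormalBasis ℂ (eigenspace (T : E →ₗ[ℂ] E) (r : ℂ)) k := rfl

theorem PositiveIndex.orthonormal_vector (hT' : T.IsSymmetric) :
    Orthonormal ℂ (PositiveIndex.vector T) := by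
  rw [orthonormal_iff_ite]
  rintro ⟨⟨r, k⟩, hr, hk⟩ ⟨⟨s, l⟩, hs, hl⟩
  by_cases hrs : r = s
  · subst hrs
    have : FiniteDimensional ℂ (eigenspace (T : E →ₗ[ℂ] E) ((OrderDual.ofDual r : ℝ) : ℂ)) :=
      Module.finite_of_finrank_pos (lt_of_le_of_lt (Nat.zero_le _) hk)
    have h := orthonormal_iff_ite.1 (stdOrthonormalBasis ℂ
      (eigenspace (T : E →ₗ[ℂ] E) ((OrderDual.ofDual r : ℝ) : ℂ))).orthonormal ⟨k, hk⟩ ⟨l, hl⟩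
    refine Eq.trans h ?_
    by_cases hkl : k = l
    · subst hkl; simp
    · rw [if_neg, if_neg]
      · intro h'
        exact hkl (congrArg (fun p : PositiveIndex T => (ofLex p.1).2) h')
      · exact fun h' => hkl (congrArg Fin.val h')
  · refine (inner_eq_zero_of_eigenspace_ne hT' (r := OrderDual.ofDual r)
      (s := OrderDual.ofDual s) hrs (PositiveIndex.vector_mem ⟨_, hr, hk⟩)
      (PositiveIndex.vector_mem ⟨_, hs, hl⟩)).trans ?_
    rw [if_neg]
    intro h'
    exact hrs (congrArg (fun p : PositiveIndex T => (ofLex p.1).1) h')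

/-- A compact symmetric nonnegative operator kills everything orthogonal to the eigenvectors
attached to its positive eigenvalues. -/
theorem apply_eq_zero_of_orthogonal_vector [CompleteSpace E] (hT : IsCompactOperator T)
    (hT' : T.IsSymmetric) (hnn : ∀ x, 0 ≤ RCLike.re ⟪x, T x⟫_ℂ) {x : E}
    (hx : ∀ p : PositiveIndex T, ⟪p.vector T, x⟫_ℂ = 0) : T x = 0 := by
  refine apply_eq_zero_of_orthogonal hT hT' hnn fun r hr v hv => ?_
  have := ContinuousLinearMap.finite_dimensional_eigenspace hT (r : ℂ) (by exact_mod_cast hr.ne')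
  have h1 := (stdOrthonormalBasis ℂ (eigenspace (T : E →ₗ[ℂ] E) (r : ℂ))).sum_repr ⟨v, hv⟩
  have h2 := congrArg Subtype.val h1
  simp only [AddSubmonoidClass.coe_finsetSum, Submodule.coe_smul] at h2
  rw [← h2, sum_inner]
  refine Finset.sum_eq_zero fun k _ => ?_
  rw [inner_smul_left, ← PositiveIndex.vector_mk hr, hx, mul_zero]

/-- If the range is not finite-dimensional then there are infinitely many positive eigenvalues,
counted with multiplicity. -/
theorem infinite_positiveIndex [CompleteSpace E] (hT : IsCompactOperator T)
    (hT' : T.IsSymmetric) (hnn : ∀ x, 0 ≤ RCLike.re ⟪x, T x⟫_ℂ)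
    (hinf : ¬ FiniteDimensional ℂ (LinearMap.range (T : E →ₗ[ℂ] E))) :
    Infinite (PositiveIndex T) := by
  by_contra hfin
  rw [not_infinite_iff_finite] at hfin
  apply hinf
  have := FiniteDimensional.span_of_finite ℂ (Set.finite_range (PositiveIndex.vector T))
  set V := Submodule.span ℂ (Set.range (PositiveIndex.vector T))
  -- With V the span of the eigenvectors, T kills x minus its projection to V, so the range of T is
  -- the image of the finite-dimensional V.
  have hsub : LinearMap.range (T : E →ₗ[ℂ] E) ≤ V.map (T : E →ₗ[ℂ] E) := by
    rintro _ ⟨x, rfl⟩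
    refine ⟨V.starProjection x, Submodule.starProjection_apply_mem V x, ?_⟩
    rw [ContinuousLinearMap.coe_coe, ← sub_eq_zero, ← map_sub]
    refine apply_eq_zero_of_orthogonal_vector hT hT' hnn fun p => ?_
    rw [← neg_sub, inner_neg_right, neg_eq_zero]
    exact (Submodule.mem_orthogonal V _).1 (V.sub_starProjection_mem_orthogonal x) _
      (Submodule.subset_span ⟨p, rfl⟩)
  exact Submodule.finiteDimensional_of_le hsub

theorem mk_value_eq {r : ℝ} (hr : 0 < r) :
    Cardinal.mk {p : PositiveIndex T // p.value = r} =
      Module.finrank ℂ (eigenspace (T : E →ₗ[ℂ] E) (r : ℂ)) := by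
  rw [← Fintype.card_fin (Module.finrank ℂ (eigenspace (T : E →ₗ[ℂ] E) (r : ℂ))),
    ← Cardinal.mk_fintype]
  refine Cardinal.mk_congr (Equiv.symm (Equiv.ofBijective
    (fun k => ⟨⟨toLex (OrderDual.toDual r, k.1), hr, k.2⟩, rfl⟩) ⟨?_, ?_⟩))
  · intro k l hkl
    exact Fin.ext (congrArg
      (fun p : {p : PositiveIndex T // p.value = r} => (ofLex p.1.1).2) hkl)
  · rintro ⟨⟨⟨s, k⟩, hs, hk⟩, hp⟩
    change OrderDual.ofDual s = r at hp
    subst hp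
    exact ⟨⟨k, hk⟩, rfl⟩

/-- The decreasing enumeration of the positive eigenvalues of a compact symmetric nonnegative
operator of infinite rank, with orthonormal eigenvectors. -/
theorem exists_eigenvalue_enumeration [CompleteSpace E] (hT : IsCompactOperator T)
    (hT' : T.IsSymmetric) (hnn : ∀ x, 0 ≤ RCLike.re ⟪x, T x⟫_ℂ)
    (hinf : ¬ FiniteDimensional ℂ (LinearMap.range (T : E →ₗ[ℂ] E))) :
    ∃ (ρ : ℕ → ℝ) (g : ℕ → E), (∀ m, 0 < ρ m) ∧ Antitone ρ ∧
      (∀ r : ℝ, 0 < r → Cardinal.mk {m : ℕ // ρ m = r} =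
        Module.finrank ℂ (eigenspace (T : E →ₗ[ℂ] E) (r : ℂ))) ∧
      Orthonormal ℂ g ∧ ∀ m, T (g m) = (ρ m : ℂ) • g m := by
  have := infinite_positiveIndex hT hT' hnn hinf
  obtain ⟨e⟩ := exists_orderIso_nat_of_finite_Iic (PositiveIndex.finite_Iic hT hT')
  refine ⟨fun m => (e m).value, fun m => (e m).vector T, fun m => (e m).2.1,
    fun m n h => PositiveIndex.value_antitone (e.monotone h), fun r hr => ?_,
    (PositiveIndex.orthonormal_vector hT').comp _ e.injective,
    fun m => mem_eigenspace_iff.1 (PositiveIndex.vector_mem _)⟩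
  rw [← mk_value_eq hr]
  exact Cardinal.mk_congr (e.toEquiv.subtypeEquiv fun m => Iff.rfl)

/-- Conversely, an orthonormal sequence of eigenvectors that exhausts the multiplicities of the
positive eigenvalues has its orthogonal complement in the kernel. -/
theorem apply_eq_zero_of_orthogonal_enumeration [CompleteSpace E] (hT : IsCompactOperator T)
    (hT' : T.IsSymmetric) (hnn : ∀ x, 0 ≤ RCLike.re ⟪x, T x⟫_ℂ) {ρ : ℕ → ℝ} {g : ℕ → E}
    (hmult : ∀ r : ℝ, 0 < r → Nat.card {m : ℕ // ρ m = r} =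
      Module.finrank ℂ (eigenspace (T : E →ₗ[ℂ] E) (r : ℂ)))
    (hg : Orthonormal ℂ g) (heig : ∀ m, T (g m) = (ρ m : ℂ) • g m) {x : E}
    (hx : ∀ m, ⟪g m, x⟫_ℂ = 0) : T x = 0 := by
  refine apply_eq_zero_of_orthogonal hT hT' hnn fun r hr v hv => ?_
  have hfd := ContinuousLinearMap.finite_dimensional_eigenspace hT (r : ℂ) (by exact_mod_cast hr.ne')
  let u : {m : ℕ // ρ m = r} → eigenspace (T : E →ₗ[ℂ] E) (r : ℂ) := fun m =>
    ⟨g m, mem_eigenspace_iff.2 ((heig m).trans (by rw [m.2]))⟩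
  have hu : LinearIndependent ℂ u :=
    LinearIndependent.of_comp (Submodule.subtype _)
      ((hg.comp _ Subtype.val_injective).linearIndependent)
  have hm := hmult r hr
  -- `Nat.card` is 0 on infinite types, so finiteness must come from independence in a
  -- finite-dimensional eigenspace. The count then makes these g m a basis of it.
  have hfin : Finite {m : ℕ // ρ m = r} := hu.finite
  have := Fintype.ofFinite {m : ℕ // ρ m = r}
  have hspan : Submodule.span ℂ (Set.range u) = ⊤ := by
    refine hu.span_eq_top_of_card_eq_finrank' ?_
    rw [← hm, Nat.card_eq_fintype_card]
  have hmem : (⟨v, hv⟩ : eigenspace (T : E →ₗ[ℂ] E) (r : ℂ)) ∈ Submodule.span ℂ (Set.range u) := by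
    rw [hspan]; trivial
  obtain ⟨a, ha⟩ := (Submodule.mem_span_range_iff_exists_fun ℂ).1 hmem
  have h2 := congrArg Subtype.val ha
  simp only [AddSubmonoidClass.coe_finsetSum, Submodule.coe_smul] at h2
  rw [← h2, sum_inner]
  exact Finset.sum_eq_zero fun k _ => by rw [inner_smul_left, hx, mul_zero]

end CompactSpectral

end

/-! ### Compactness of the convolution operator. -/

noncomputable section
namespace WeightedFourier
open Filter Topology
open scoped InnerProductSpace

/-- The derivative is -sinh/cosh², and |sinh| ≤ 1 + sinh² = cosh². -/
theorem abs_sech_sub_le (x y : ℝ) : |sech x - sech y| ≤ |x - y| := by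
  have hd : ∀ z : ℝ, HasDerivAt sech (-Real.sinh z / Real.cosh z ^ 2) z := by
    intro z
    have := (Real.hasDerivAt_cosh z).inv (Real.cosh_pos z).ne'
    refine this.congr_of_eventuallyEq (Eventually.of_forall fun t => ?_)
    simp [sech]
  have hb : ∀ z ∈ Set.univ, ‖-Real.sinh z / Real.cosh z ^ 2‖ ≤ 1 := by
    intro z _
    rw [Real.norm_eq_abs, abs_div, abs_neg, abs_of_pos (pow_pos (Real.cosh_pos z) 2),
      div_le_one (pow_pos (Real.cosh_pos z) 2), abs_le]
    have := Real.cosh_sq z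
    constructor <;> nlinarith [sq_nonneg (Real.sinh z + 1), sq_nonneg (Real.sinh z - 1)]
  have h := convex_univ.norm_image_sub_le_of_norm_hasDerivWithin_le
    (fun z _ => (hd z).hasDerivWithinAt) hb (Set.mem_univ y) (Set.mem_univ x)
  simpa using h

theorem norm_convolutionKernel_sub_le (a x x' y : ℝ) :
    ‖convolutionKernel a x y - convolutionKernel a x' y‖ ≤
      |Real.pi * a| * (|Real.pi * a / 2| * |x - x'|) := by
  unfold convolutionKernel
  rw [← Complex.ofReal_sub, Complex.norm_real, ← mul_sub, norm_mul, Real.norm_eq_abs,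
    Real.norm_eq_abs]
  refine mul_le_mul_of_nonneg_left ((abs_sech_sub_le _ _).trans_eq ?_) (abs_nonneg _)
  rw [← abs_mul]
  congr 1
  ring

theorem memLp_convolutionKernel (a x : ℝ) : MemLp (convolutionKernel a x) 2 intervalMeasure :=
  MemLp.of_bound ((continuous_convolutionKernel a).uncurry_left x).aestronglyMeasurable _
    (Eventually.of_forall fun y => norm_convolutionKernel_le a x y)

/-- The points of `(-1, 1)` in the `j`-th cell of the grid of mesh `1 / N`. -/
def cell (N : ℕ) (j : ℤ) : Set ℝ := {x | ⌊(N : ℝ) * x⌋ = j}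

theorem measurableSet_cell (N : ℕ) (j : ℤ) : MeasurableSet (cell N j) :=
  (Int.measurable_floor.comp (measurable_const_mul (N : ℝ))) (measurableSet_singleton j)

/-- The finite-rank operator obtained by freezing the first variable of the convolution kernel on
each cell. -/
def stepConvolution (a : ℝ) (N : ℕ) : L2Interval →L[ℂ] L2Interval :=
  -- For x in (-1, 1) and N > 0, the floor of N x runs from -N to N - 1.
  ∑ j ∈ Finset.Ico (-N : ℤ) N,
    (innerSL ℂ ((memLp_convolutionKernel a (j / N)).toLp _)).smulRight
      (indicatorConstLp 2 (measurableSet_cell N j) (measure_ne_top intervalMeasure _) (1 : ℂ))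

/-- Each summand factors through ℂ. -/
theorem isCompactOperator_stepConvolution (a : ℝ) (N : ℕ) :
    IsCompactOperator (stepConvolution a N) := by
  have : stepConvolution a N ∈ compactOperator (RingHom.id ℂ) L2Interval L2Interval := by
    refine Submodule.sum_mem _ fun j _ => ?_
    have h := (isCompactOperator_id (E := ℂ)).comp_clm
      (innerSL ℂ ((memLp_convolutionKernel a (j / N)).toLp (convolutionKernel a (j / N))))
    exact h.clm_comp ((ContinuousLinearMap.id ℂ ℂ).smulRight
      (indicatorConstLp 2 (measurableSet_cell N j) (measure_ne_top intervalMeasure _) (1 : ℂ)))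
  exact this

theorem finiteConvolution_coeFn (a : ℝ) (h : L2Interval) :
    finiteConvolution a h =ᵐ[intervalMeasure]
      kernelIntegral intervalMeasure (convolutionKernel a) h :=
  MemLp.coeFn_toLp (memLp_kernelIntegral (continuous_convolutionKernel a)
    (norm_convolutionKernel_le a) (integrable_of_L2Interval h))

theorem inner_convolutionKernel (a x : ℝ) (h : L2Interval) :
    ⟪(memLp_convolutionKernel a x).toLp _, h⟫_ℂ =
      kernelIntegral intervalMeasure (convolutionKernel a) h x := by
  rw [L2.inner_def, kernelIntegral]
  refine integral_congr_ae ?_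
  filter_upwards [(memLp_convolutionKernel a x).coeFn_toLp] with y hy
  rw [hy, RCLike.inner_apply, mul_comm]
  congr 1
  exact Complex.conj_ofReal _

theorem stepConvolution_coeFn (a : ℝ) {N : ℕ} (hN : 0 < N) (h : L2Interval) :
    ∀ᵐ x ∂intervalMeasure, stepConvolution a N h x =
      kernelIntegral intervalMeasure (convolutionKernel a) h (⌊(N : ℝ) * x⌋ / N) := by
  have h1 : stepConvolution a N h = ∑ j ∈ Finset.Ico (-N : ℤ) N,
      kernelIntegral intervalMeasure (convolutionKernel a) h (j / N) •
        indicatorConstLp 2 (measurableSet_cell N j) (measure_ne_top intervalMeasure _) (1 : ℂ) := by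
    simp only [stepConvolution, sum_apply,
      ContinuousLinearMap.smulRight_apply, innerSL_apply_apply, inner_convolutionKernel]
  have h2 : ∀ j : ℤ, ∀ᵐ x ∂intervalMeasure,
      (kernelIntegral intervalMeasure (convolutionKernel a) h (j / N) •
        indicatorConstLp 2 (measurableSet_cell N j) (measure_ne_top intervalMeasure _) (1 : ℂ) :
        L2Interval) x = if ⌊(N : ℝ) * x⌋ = j then
          kernelIntegral intervalMeasure (convolutionKernel a) h (j / N) else 0 := by
    intro j
    filter_upwards [Lp.coeFn_smul (kernelIntegral intervalMeasure (convolutionKernel a) h (j / N))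
      (indicatorConstLp 2 (measurableSet_cell N j) (measure_ne_top intervalMeasure _) (1 : ℂ)),
      indicatorConstLp_coeFn (p := 2) (hs := measurableSet_cell N j)
        (hμs := measure_ne_top intervalMeasure _) (c := (1 : ℂ))] with x hx hx'
    classical
    rw [hx, Pi.smul_apply, hx', Set.indicator_apply]
    by_cases hc : ⌊(N : ℝ) * x⌋ = j <;> simp [cell, hc]
  have h3 := ae_all_iff.2 h2
  filter_upwards [h3, Lp.coeFn_finsetSum (Finset.Ico (-N : ℤ) N) (fun j : ℤ =>
    (kernelIntegral intervalMeasure (convolutionKernel a) h (j / N) •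
        indicatorConstLp 2 (measurableSet_cell N j) (measure_ne_top intervalMeasure _) (1 : ℂ) :
        L2Interval)), ae_restrict_mem measurableSet_Ioo] with x hx hsum hmem
  rw [h1, hsum]
  simp only [Finset.sum_apply, hx]
  rw [Finset.sum_ite_eq, if_pos]
  have hN' : (0 : ℝ) < N := by exact_mod_cast hN
  rw [Finset.mem_Ico, Int.le_floor, Int.floor_lt]
  push_cast
  constructor <;> nlinarith [hmem.1, hmem.2]

/-- The kernel is Lipschitz in its first variable uniformly in the second, and freezing moves that
variable by at most 1/N. Only the decay in N matters. -/
theorem norm_finiteConvolution_sub_stepConvolution_le (a : ℝ) {N : ℕ} (hN : 0 < N) :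
    ‖finiteConvolution a - stepConvolution a N‖ ≤
      (intervalMeasure.real Set.univ) ^ (2 : ENNReal).toReal⁻¹ *
        (|Real.pi * a| * (|Real.pi * a / 2| * (1 / N)) *
          (intervalMeasure Set.univ ^ (1 / 2 : ℝ)).toReal) := by
  refine ContinuousLinearMap.opNorm_le_bound _ (by positivity) fun h => ?_
  rw [mul_assoc]
  refine Lp.norm_le_of_ae_bound (by positivity) ?_
  have hN' : (0 : ℝ) < N := by exact_mod_cast hN
  filter_upwards [finiteConvolution_coeFn a h, stepConvolution_coeFn a hN h,
    Lp.coeFn_sub (finiteConvolution a h) (stepConvolution a N h)] with x h1 h2 h3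
  rw [sub_apply, h3, Pi.sub_apply, h1, h2, kernelIntegral, kernelIntegral,
    ← integral_sub
      (integrable_kernel (continuous_convolutionKernel a) (norm_convolutionKernel_le a)
        (integrable_of_L2Interval h) _)
      (integrable_kernel (continuous_convolutionKernel a) (norm_convolutionKernel_le a)
        (integrable_of_L2Interval h) _)]
  have hdist : |x - ⌊(N : ℝ) * x⌋ / N| ≤ 1 / N := by
    have e1 := Int.floor_le ((N : ℝ) * x)
    have e2 := Int.lt_floor_add_one ((N : ℝ) * x)
    have e3 : x - ⌊(N : ℝ) * x⌋ / N = (N * x - ⌊(N : ℝ) * x⌋) / N := by field_simp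
    rw [e3, abs_div, abs_of_pos hN', div_le_div_iff_of_pos_right hN', abs_le]
    constructor <;> linarith
  calc _ ≤ ∫ y, |Real.pi * a| * (|Real.pi * a / 2| * (1 / N)) * ‖h y‖ ∂intervalMeasure := by
        refine norm_integral_le_of_norm_le ((integrable_of_L2Interval h).norm.const_mul _)
          (Eventually.of_forall fun y => ?_)
        rw [← sub_mul, norm_mul]
        refine mul_le_mul_of_nonneg_right
          ((norm_convolutionKernel_sub_le a _ _ y).trans ?_) (norm_nonneg _)
        gcongr
    _ ≤ _ := by
        rw [integral_const_mul, mul_assoc _ (ENNReal.toReal _)]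
        exact mul_le_mul_of_nonneg_left (integral_norm_le_L2Interval h) (by positivity)

theorem isCompactOperator_finiteConvolution (a : ℝ) : IsCompactOperator (finiteConvolution a) := by
  have hlim : Tendsto (stepConvolution a) atTop (𝓝 (finiteConvolution a)) := by
    rw [tendsto_iff_norm_sub_tendsto_zero]
    refine squeeze_zero' (Eventually.of_forall fun N => norm_nonneg _)
      ((eventually_gt_atTop 0).mono fun N hN => (norm_sub_rev _ _).trans_le
        (norm_finiteConvolution_sub_stepConvolution_le a hN)) ?_
    have h := tendsto_one_div_atTop_nhds_zero_nat (𝕜 := ℝ)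
    have h2 := (((h.const_mul |Real.pi * a / 2|).const_mul |Real.pi * a|).mul_const
      (intervalMeasure Set.univ ^ (1 / 2 : ℝ)).toReal).const_mul
      ((intervalMeasure.real Set.univ) ^ (2 : ENNReal).toReal⁻¹)
    simpa using h2
  exact isCompactOperator_of_tendsto hlim (Eventually.of_forall (isCompactOperator_stepConvolution a))

end WeightedFourier
end

/-! ### The Fourier transform of the hyperbolic secant. -/

noncomputable section

open Complex in
-- Euler's reflection formula, with sin(π/2 + iπw) = cos(iπw) = cosh(πw).
theorem betaIntegral_half_add_half_sub (w : ℝ) :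
    betaIntegral (1 / 2 + w * I) (1 / 2 - w * I) = ((Real.pi / Real.cosh (Real.pi * w) : ℝ) : ℂ) := by
  have h1 := Complex.Gamma_mul_Gamma_eq_betaIntegral (s := 1 / 2 + w * I) (t := 1 / 2 - w * I)
    (by simp) (by simp)
  rw [show (1 / 2 + w * I) + (1 / 2 - w * I) = 1 by ring, Complex.Gamma_one, one_mul,
    show (1 / 2 - w * I) = 1 - (1 / 2 + w * I) by ring, Complex.Gamma_mul_Gamma_one_sub] at h1
  rw [show (1 / 2 - w * I) = 1 - (1 / 2 + w * I) by ring, ← h1]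
  push_cast
  rw [show (Real.pi : ℂ) * (1 / 2 + w * I) = (Real.pi * w : ℂ) * I + Real.pi / 2 by ring,
    Complex.sin_add_pi_div_two, Complex.cos_mul_I]

open Complex in
-- The integrand of the beta integral after substituting x = sigmoid t. The Jacobian is x(1 - x),
-- and x/(1 - x) = e^t, so the product is √(x(1 - x)) e^{iwt}, where √(x(1 - x)) = sech(t/2)/2.
theorem sigmoid_mul_cpow (w t : ℝ) :
    |Real.sigmoid t * (1 - Real.sigmoid t)| •
      (((Real.sigmoid t : ℝ) : ℂ) ^ ((1 / 2 + w * I : ℂ) - 1) *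
        (1 - ((Real.sigmoid t : ℝ) : ℂ)) ^ ((1 / 2 - w * I : ℂ) - 1)) =
      (1 / 2 : ℂ) * (cexp (I * ((w * t : ℝ) : ℂ)) * ((WeightedFourier.sech (t / 2) : ℝ) : ℂ)) := by
  have hp := Real.sigmoid_pos t
  have hq : 0 < 1 - Real.sigmoid t := sub_pos.2 (Real.sigmoid_lt_one t)
  have hrel : 1 - Real.sigmoid t = Real.sigmoid t * Real.exp (-t) := by
    rw [Real.sigmoid_mul_rexp_neg, Real.sigmoid_neg]
  -- Then x = e^L and 1 - x = e^{L - t}, which turns both complex powers into exponentials.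
  set L := Real.log (Real.sigmoid t)
  have hL : Real.sigmoid t = Real.exp L := (Real.exp_log hp).symm
  have hM : 1 - Real.sigmoid t = Real.exp (L - t) := by
    rw [hrel, Real.exp_sub, Real.exp_neg, hL]; rfl
  have hpow : ∀ (x : ℝ) (s : ℂ), ((Real.exp x : ℝ) : ℂ) ^ s = cexp (x * s) := by
    intro x s
    rw [Complex.cpow_def_of_ne_zero (by simp), ← Complex.ofReal_log (Real.exp_pos x).le,
      Real.log_exp]
  have hsech : WeightedFourier.sech (t / 2) = 2 * Real.exp (L - t / 2) := by
    have h2 : Real.exp L * (1 + Real.exp (-t)) = 1 := by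
      rw [← hL, Real.sigmoid_def]; field_simp
    have h3 : Real.exp (-t) = Real.exp (-(t / 2)) * Real.exp (-(t / 2)) := by
      rw [← Real.exp_add]; ring_nf
    have h4 : Real.exp (t / 2) * Real.exp (-(t / 2)) = 1 := by
      rw [← Real.exp_add]; simp
    unfold WeightedFourier.sech
    rw [div_eq_iff (Real.cosh_pos _).ne', Real.cosh_eq, sub_eq_add_neg, Real.exp_add]
    rw [h3] at h2
    linear_combination -h2 - Real.exp L * h4
  rw [hsech, abs_of_pos (mul_pos hp hq), Complex.real_smul,
    show (1 - ((Real.sigmoid t : ℝ) : ℂ)) = ((1 - Real.sigmoid t : ℝ) : ℂ) by push_cast; rfl,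
    hM, hL, hpow, hpow]
  push_cast
  have : ∀ x : ℂ, (1 / 2 : ℂ) * (cexp (I * (w * t)) * (2 * x)) = cexp (I * (w * t)) * x := by
    intro x; ring
  rw [this]
  simp only [← Complex.exp_add]
  congr 1
  ring

/-- The Fourier transform of the hyperbolic secant. -/
theorem integral_exp_mul_sech_half (w : ℝ) :
    ∫ t : ℝ, Complex.exp (Complex.I * ((w * t : ℝ) : ℂ)) *
      ((WeightedFourier.sech (t / 2) : ℝ) : ℂ) =
      ((2 * Real.pi / Real.cosh (Real.pi * w) : ℝ) : ℂ) := by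
  have h1 := integral_image_eq_integral_abs_deriv_smul (s := Set.univ) (f := Real.sigmoid)
    MeasurableSet.univ (fun x _ => (Real.hasDerivAt_sigmoid x).hasDerivWithinAt)
    Real.sigmoid_injective.injOn
    (fun x : ℝ => (x : ℂ) ^ ((1 / 2 + w * Complex.I : ℂ) - 1) *
        (1 - (x : ℂ)) ^ ((1 / 2 - w * Complex.I : ℂ) - 1))
  simp only [sigmoid_mul_cpow] at h1
  have h2 := betaIntegral_half_add_half_sub w
  rw [Complex.betaIntegral, intervalIntegral.integral_of_le zero_le_one, integral_Ioc_eq_integral_Ioo,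
    ← Real.range_sigmoid, ← Set.image_univ, h1, setIntegral_univ, integral_const_mul] at h2
  have h3 := congrArg (fun z : ℂ => 2 * z) h2
  simp only [← mul_assoc] at h3
  norm_num at h3
  rw [mul_div_assoc]
  push_cast
  exact h3

theorem integral_exp_mul_sech {b : ℝ} (hb : 0 < b) (w : ℝ) :
    ∫ t : ℝ, Complex.exp (Complex.I * ((w * t : ℝ) : ℂ)) *
      ((WeightedFourier.sech (b * t) : ℝ) : ℂ) =
      ((Real.pi / b * WeightedFourier.sech (Real.pi * w / (2 * b)) : ℝ) : ℂ) := by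
  have h1 := Measure.integral_comp_mul_left (fun t : ℝ => Complex.exp (Complex.I *
    (((w / (2 * b)) * t : ℝ) : ℂ)) * ((WeightedFourier.sech (t / 2) : ℝ) : ℂ)) (2 * b)
  rw [integral_exp_mul_sech_half, abs_of_pos (by positivity)] at h1
  have h2 : ∀ t : ℝ, w / (2 * b) * (2 * b * t) = w * t := fun t => by field_simp
  have h3 : ∀ t : ℝ, 2 * b * t / 2 = b * t := fun t => by ring
  simp only [h2, h3] at h1
  rw [h1, Complex.real_smul, ← Complex.ofReal_mul]
  congr 1
  unfold WeightedFourier.sech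
  rw [← mul_div_assoc Real.pi]
  field_simp
end

/-! ### Injectivity of the truncated Fourier transform, and infinite dimension of its domain. -/

noncomputable section

open Filter Topology
open scoped FourierTransform SchwartzMap

/-- An integrable function whose Fourier transform vanishes is zero almost everywhere. -/
theorem MeasureTheory.Integrable.ae_eq_zero_of_fourier_eq_zero {f : ℝ → ℂ} (hf : Integrable f)
    (h : ∀ ξ : ℝ, 𝓕 f ξ = 0) : ∀ᵐ x, f x = 0 := by
  refine ae_eq_zero_of_integral_contDiff_smul_eq_zero hf.locallyIntegrable fun g hg hg' => ?_
  -- The test function g is the Fourier transform of a Schwartz function ψ. The multiplication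
  -- formula moves the transform from ψ to f, where it vanishes.
  let φ : 𝓢(ℝ, ℂ) := HasCompactSupport.toSchwartzMap (f := fun x => ((g x : ℝ) : ℂ))
    (hg'.comp_left (g := fun x : ℝ => (x : ℂ)) rfl) (Complex.ofRealCLM.contDiff.comp hg)
  let ψ : 𝓢(ℝ, ℂ) := 𝓕⁻ φ
  have hφ : 𝓕 ψ = φ := FourierTransform.fourier_fourierInv_eq φ
  have h1 := VectorFourier.integral_fourierIntegral_smul_eq_flip (μ := volume) (ν := volume)
    (L := innerₗ ℝ) Real.continuous_fourierChar (by exact continuous_inner) hf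
    ψ.integrable
  have h2 : ∀ x : ℝ, VectorFourier.fourierIntegral Real.fourierChar volume (innerₗ ℝ).flip
      ψ x = (g x : ℂ) := by
    intro x
    rw [flip_innerₗ]
    have := congrArg (fun u : 𝓢(ℝ, ℂ) => u x) hφ
    simp only [SchwartzMap.fourier_coe] at this
    exact this
  have h3 : ∀ x : ℝ, VectorFourier.fourierIntegral Real.fourierChar volume (innerₗ ℝ) f x = 0 := h
  simp only [h2, h3, zero_smul, integral_zero] at h1
  rw [h1]
  refine integral_congr_ae (Eventually.of_forall fun x => ?_)
  simp [mul_comm]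

/-- The two-sided Laplace transform of a function with exponential decay is analytic on a strip. -/
theorem differentiableOn_integral_exp_mul {f : ℝ → ℂ} {δ : ℝ} (hδ : 0 < δ)
    (hm : AEStronglyMeasurable f) (hf : Integrable fun t => Real.exp (2 * δ * |t|) * ‖f t‖) :
    DifferentiableOn ℂ (fun z : ℂ => ∫ t : ℝ, Complex.exp (z * t) * f t) {z | |z.re| < δ} := by
  intro z hz
  have hopen : IsOpen {z : ℂ | |z.re| < δ} := isOpen_lt (by fun_prop) continuous_const
  have hexp : ∀ z ∈ {z : ℂ | |z.re| < δ}, ∀ t : ℝ, ‖Complex.exp (z * t)‖ ≤ Real.exp (δ * |t|) := by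
    intro z hz t
    rw [Complex.norm_exp, Real.exp_le_exp]
    simp only [Complex.mul_re, Complex.ofReal_re, Complex.ofReal_im, mul_zero, sub_zero]
    exact (le_abs_self _).trans (by rw [abs_mul]; exact mul_le_mul_of_nonneg_right (le_of_lt hz) (abs_nonneg t))
  have hmeas : ∀ z : ℂ, AEStronglyMeasurable (fun t : ℝ => Complex.exp (z * t) * f t) := fun z =>
    (Continuous.aestronglyMeasurable (by fun_prop)).mul hm
  -- Differentiation in z brings down a factor t, absorbed by a second e^{δ|t|}; hence the 2δ in the
  -- hypothesis.
  have hbound : ∀ t : ℝ, |t| * Real.exp (δ * |t|) ≤ δ⁻¹ * Real.exp (2 * δ * |t|) := by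
    intro t
    have h1 : δ * |t| ≤ Real.exp (δ * |t|) := by linarith [Real.add_one_le_exp (δ * |t|)]
    rw [show 2 * δ * |t| = δ * |t| + δ * |t| by ring, Real.exp_add, ← mul_assoc]
    refine mul_le_mul_of_nonneg_right ?_ (Real.exp_pos _).le
    rw [← div_eq_inv_mul, le_div_iff₀ hδ]
    linarith
  have h := hasDerivAt_integral_of_dominated_loc_of_deriv_le (μ := volume)
    (F := fun (z : ℂ) (t : ℝ) => Complex.exp (z * t) * f t)
    (F' := fun (z : ℂ) (t : ℝ) => (t * Complex.exp (z * t)) * f t)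
    (bound := fun t => δ⁻¹ * (Real.exp (2 * δ * |t|) * ‖f t‖)) (hopen.mem_nhds hz)
    (Eventually.of_forall hmeas) ?_ ?_ ?_ (hf.const_mul _) ?_
  · exact h.2.differentiableAt.differentiableWithinAt
  · refine hf.mono' (hmeas z) (Eventually.of_forall fun t => ?_)
    rw [norm_mul]
    refine mul_le_mul_of_nonneg_right ((hexp z hz t).trans (Real.exp_le_exp.2 ?_)) (norm_nonneg _)
    nlinarith [abs_nonneg t]
  · exact (Continuous.aestronglyMeasurable (by fun_prop)).mul hm
  · refine Eventually.of_forall fun t w hw => ?_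
    rw [norm_mul, norm_mul, Complex.norm_real, Real.norm_eq_abs, ← mul_assoc]
    exact mul_le_mul_of_nonneg_right ((mul_le_mul_of_nonneg_left (hexp w hw t)
      (abs_nonneg t)).trans (hbound t)) (norm_nonneg _)
  · refine Eventually.of_forall fun t w _ => ?_
    have h1 : HasDerivAt (fun z : ℂ => z * (t : ℂ)) (t : ℂ) w := by
      simpa using (hasDerivAt_id w).mul_const (t : ℂ)
    have h2 := h1.cexp.mul_const (f t)
    rw [mul_comm (Complex.exp _) (t : ℂ)] at h2
    exact h2

namespace WeightedFourier

/-- With y = |x|/2 this is e^y cosh y ≤ 2 cosh² y ≤ 2 cosh 2y. -/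
theorem exp_half_abs_mul_sech_le (x : ℝ) : Real.exp (|x| / 2) * sech x ≤ 2 * sech (x / 2) := by
  unfold sech
  rw [← Real.cosh_abs x, ← Real.cosh_abs (x / 2), abs_div, abs_two]
  set y := |x| / 2
  have hy : |x| = 2 * y := by simp only [y]; ring
  rw [hy, mul_one_div, mul_one_div, div_le_div_iff₀ (Real.cosh_pos _) (Real.cosh_pos _),
    Real.cosh_two_mul]
  have h1 := Real.cosh_sq y
  have h2 : Real.exp y ≤ 2 * Real.cosh y := by
    rw [Real.cosh_eq]; linarith [Real.exp_pos (-y)]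
  have h3 := Real.cosh_pos y
  nlinarith [sq_nonneg (Real.sinh y), mul_le_mul_of_nonneg_right h2 h3.le]

/-- With E the exponential factor, 2E‖f‖ ≤ cosh(bt)‖f‖² + E² sech(bt). The first term is integrable
because f is in the weighted space. The rate b/8 makes E² = e^{b|t|/2}, so the second is at most 2
sech(bt/2). -/
theorem integrable_exp_mul_norm {b : ℝ} (hb : 0 < b) (f : L2Cosh b) :
    Integrable fun t => Real.exp (2 * (b / 8) * |t|) * ‖f t‖ := by
  have hsq := (memLp_two_iff_integrable_sq_norm (Lp.memLp f).1).1 (Lp.memLp f)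
  rw [integrable_coshMeasure_iff] at hsq
  have hs := (integrable_sech_mul (half_pos hb)).const_mul 2
  refine (hsq.add hs).mono' ((Continuous.aestronglyMeasurable (by fun_prop)).mul
    (integrable_of_L2Cosh hb f).1.norm) (Eventually.of_forall fun t => ?_)
  have h1 := exp_half_abs_mul_sech_le (b * t)
  have h2 : Real.exp (|b * t| / 2) = Real.exp (2 * (b / 8) * |t|) ^ 2 := by
    rw [← Real.exp_nat_mul, abs_mul, abs_of_pos hb]
    congr 1; push_cast; ring
  rw [h2, show b * t / 2 = b / 2 * t by ring] at h1
  have h3 : Real.cosh (b * t) * sech (b * t) = 1 := by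
    unfold sech; field_simp [(Real.cosh_pos (b * t)).ne']
  rw [Real.norm_of_nonneg (by positivity), Pi.add_apply, smul_eq_mul]
  refine le_trans ?_ (add_le_add_right h1 _)
  have h4 := Real.cosh_pos (b * t)
  have h5 := sech_pos (b * t)
  set E := Real.exp (2 * (b / 8) * |t|)
  set n := ‖f t‖
  have h6 : 0 ≤ sech (b * t) * (Real.cosh (b * t) * n - E) ^ 2 := by positivity
  have h7 : sech (b * t) * (Real.cosh (b * t) * n - E) ^ 2 =
      Real.cosh (b * t) * n ^ 2 - 2 * (E * n) + E ^ 2 * sech (b * t) := by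
    linear_combination (Real.cosh (b * t) * n ^ 2 - 2 * E * n) * h3
  have h8 : 0 ≤ E * n := by positivity
  linarith

theorem truncatedFourier_coeFn {b c : ℝ} (hb : 0 < b) (f : L2Cosh b) :
    truncatedFourier b c hb f =ᵐ[intervalMeasure] kernelIntegral volume (fourierKernel c) f :=
  MemLp.coeFn_toLp (memLp_kernelIntegral (continuous_fourierKernel c) (norm_fourierKernel_le c)
    (integrable_of_L2Cosh hb f))

theorem injective_truncatedFourier {b c : ℝ} (hb : 0 < b) (hc : 0 < c) :
    Function.Injective (truncatedFourier b c hb) := by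
  rw [injective_iff_map_eq_zero]
  intro f hf
  set G : ℂ → ℂ := fun z => ∫ t : ℝ, Complex.exp (z * t) * f t with hG
  have hopen : IsOpen {z : ℂ | |z.re| < b / 8} := isOpen_lt (by fun_prop) continuous_const
  have han : AnalyticOnNhd ℂ G {z : ℂ | |z.re| < b / 8} :=
    (differentiableOn_integral_exp_mul (by positivity) (integrable_of_L2Cosh hb f).1
      (integrable_exp_mul_norm hb f)).analyticOnNhd hopen
  have hconv : IsPreconnected {z : ℂ | |z.re| < b / 8} := by
    have : {z : ℂ | |z.re| < b / 8} = Complex.reLm ⁻¹' Set.Ioo (-(b / 8)) (b / 8) := by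
      ext z; simp [abs_lt]
    rw [this]
    exact ((convex_Ioo _ _).linear_preimage Complex.reLm).isPreconnected
  have hker : ∀ x : ℝ, kernelIntegral volume (fourierKernel c) f x = G (Complex.I * (c * x : ℝ)) := by
    intro x
    simp only [kernelIntegral, fourierKernel, hG]
    congr 1
    funext t
    congr 2
    push_cast; ring
  -- Vanishing in L² is only almost everywhere; continuity makes it pointwise.
  have hzero : Set.EqOn (kernelIntegral volume (fourierKernel c) f) 0 (Set.Ioo (-1 : ℝ) 1) := by
    refine Measure.eqOn_open_of_ae_eq (μ := volume) ?_ isOpen_Ioo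
      (continuous_kernelIntegral (continuous_fourierKernel c) (norm_fourierKernel_le c)
        (integrable_of_L2Cosh hb f)).continuousOn continuousOn_const
    have h1 := truncatedFourier_coeFn (c := c) hb f
    rw [hf] at h1
    exact h1.symm.trans (Lp.coeFn_zero ℂ 2 intervalMeasure)
  have hfreq : ∃ᶠ z in 𝓝[≠] (0 : ℂ), G z = 0 := by
    have ht : Tendsto (fun x : ℝ => Complex.I * ((c * x : ℝ) : ℂ)) (𝓝[≠] 0) (𝓝[≠] 0) := by
      refine tendsto_nhdsWithin_iff.2 ⟨?_, ?_⟩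
      · have : Continuous fun x : ℝ => Complex.I * ((c * x : ℝ) : ℂ) := by fun_prop
        have h := this.tendsto 0
        simp only [mul_zero, Complex.ofReal_zero] at h
        exact h.mono_left nhdsWithin_le_nhds
      · filter_upwards [self_mem_nhdsWithin] with x hx
        have hx' : x ≠ 0 := hx
        simp [hc.ne', hx']
    refine ht.frequently (Eventually.frequently ?_)
    filter_upwards [nhdsWithin_le_nhds (isOpen_Ioo.mem_nhds
      (show (0 : ℝ) ∈ Set.Ioo (-1 : ℝ) 1 by norm_num))] with x hx
    rw [← hker]
    exact hzero hx
  -- The zeros icx accumulate at 0, so G vanishes on the strip, in particular at the points -2πiξ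
  -- that give the full Fourier transform of f.
  have hG0 := han.eqOn_zero_of_preconnected_of_frequently_eq_zero hconv
    (by simp only [Set.mem_ofPred_eq, Complex.zero_re, abs_zero]; positivity) hfreq
  have hF : ∀ ξ : ℝ, 𝓕 (f : ℝ → ℂ) ξ = 0 := by
    intro ξ
    rw [Real.fourier_eq']
    have h1 : G (Complex.I * ((-2 * Real.pi * ξ : ℝ) : ℂ)) = 0 :=
      hG0 (by
        simp only [Set.mem_ofPred_eq, Complex.re_mul_ofReal, Complex.I_re, zero_mul, abs_zero]
        positivity)
    rw [← h1]
    simp only [hG]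
    refine integral_congr_ae (Eventually.of_forall fun t => ?_)
    simp only [smul_eq_mul, RCLike.inner_apply, conj_trivial]
    congr 2
    push_cast; ring
  have hae := (integrable_of_L2Cosh hb f).ae_eq_zero_of_fourier_eq_zero hF
  rw [Lp.eq_zero_iff_ae_eq_zero]
  have hac : coshMeasure b ≪ volume := withDensity_absolutelyContinuous _ _
  exact hac.ae_le hae

theorem coshMeasure_Ico_ne_top (b : ℝ) (n : ℕ) : coshMeasure b (Set.Ico (n : ℝ) (n + 1)) ≠ ⊤ := by
  have h : IntegrableOn (fun t => Real.cosh (b * t)) (Set.Ico (n : ℝ) (n + 1)) :=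
    (Continuous.integrableOn_Icc (by fun_prop)).mono_set Set.Ico_subset_Icc_self
  rw [coshMeasure, withDensity_apply _ measurableSet_Ico,
    ← ofReal_integral_eq_lintegral_ofReal h (Eventually.of_forall fun t => (Real.cosh_pos _).le)]
  exact ENNReal.ofReal_ne_top

theorem coshMeasure_Ico_ne_zero (b : ℝ) (n : ℕ) : coshMeasure b (Set.Ico (n : ℝ) (n + 1)) ≠ 0 := by
  intro h
  have := volume_absolutelyContinuous b h
  simp at this

/-- Indicators of disjoint unit intervals are nonzero and mutually orthogonal. -/
theorem not_finiteDimensional_L2Cosh (b : ℝ) : ¬ FiniteDimensional ℂ (L2Cosh b) := by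
  intro hfd
  have hli : LinearIndependent ℂ fun n : ℕ => (indicatorConstLp 2 (measurableSet_Ico)
      (coshMeasure_Ico_ne_top b n) (1 : ℂ) : L2Cosh b) := by
    refine linearIndependent_of_ne_zero_of_inner_eq_zero (𝕜 := ℂ) (fun n h => ?_) fun m n hmn => ?_
    · have h1 := congrArg norm h
      rw [norm_indicatorConstLp (by norm_num) (by norm_num), norm_zero, norm_one, one_mul,
        Real.rpow_eq_zero measureReal_nonneg (by norm_num), measureReal_eq_zero_iff
          (coshMeasure_Ico_ne_top b n)] at h1
      exact coshMeasure_Ico_ne_zero b n h1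
    · dsimp only
      rw [L2.inner_indicatorConstLp_indicatorConstLp measurableSet_Ico measurableSet_Ico
        (coshMeasure_Ico_ne_top b m) (coshMeasure_Ico_ne_top b n)]
      have : Set.Ico (m : ℝ) (m + 1) ∩ Set.Ico (n : ℝ) (n + 1) = ∅ := by
        rw [← Set.disjoint_iff_inter_eq_empty, Set.Ico_disjoint_Ico]
        rcases lt_or_gt_of_ne hmn with h | h
        · have : (m : ℝ) + 1 ≤ n := by exact_mod_cast h
          exact (min_le_left _ _).trans (this.trans (le_max_right _ _))
        · have : (n : ℝ) + 1 ≤ m := by exact_mod_cast h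
          exact (min_le_right _ _).trans (this.trans (le_max_left _ _))
      rw [this]; simp
  exact not_finite_iff_infinite.2 (inferInstanceAs (Infinite ℕ)) hli.finite

end WeightedFourier
end

/-! ### The factorization of the convolution operator, and the singular system. -/

noncomputable section

namespace WeightedFourier
open Filter Topology
open scoped InnerProductSpace ComplexConjugate

theorem integral_kernelIntegral_mul {μ ν : Measure ℝ} [SFinite μ] [SFinite ν] {k : ℝ → ℝ → ℂ}
    {M : ℝ} {f h : ℝ → ℂ} (hk : Continuous (Function.uncurry k)) (hM : ∀ x t, ‖k x t‖ ≤ M)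
    (hf : Integrable f μ) (hh : Integrable h ν) :
    ∫ x, kernelIntegral μ k f x * h x ∂ν =
      ∫ t, f t * kernelIntegral ν (fun t x => k x t) h t ∂μ := by
  have hint : Integrable (Function.uncurry fun x t => k x t * (h x * f t)) (ν.prod μ) :=
    (hh.mul_prod hf).bdd_mul (c := M) hk.aestronglyMeasurable
      (Eventually.of_forall fun p => hM p.1 p.2)
  have h1 := integral_integral_swap hint
  calc _ = ∫ x, ∫ t, k x t * (h x * f t) ∂μ ∂ν := by
        congr 1; funext x
        rw [kernelIntegral, ← integral_mul_const]
        congr 1; funext t; ring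
    _ = _ := h1
    _ = _ := by
        congr 1; funext t
        rw [kernelIntegral, ← integral_const_mul]
        congr 1; funext x; ring

theorem integral_coshMeasure_complex (b : ℝ) (u : ℝ → ℂ) :
    ∫ t, u t ∂(coshMeasure b) = ∫ t, ((Real.cosh (b * t) : ℝ) : ℂ) * u t := by
  rw [coshMeasure_eq, integral_withDensity_eq_integral_smul (measurable_coshDensity b)]
  simp only [NNReal.smul_def, Real.coe_toNNReal _ (Real.cosh_pos _).le, Complex.real_smul]

/-- The function `t ↦ sech(b t) ∫_{-1}^1 e^{-i c t y} h(y) dy`. -/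
def adjointFunction (b c : ℝ) (h : L2Interval) (t : ℝ) : ℂ :=
  kernelIntegral intervalMeasure (fourierKernel (-c)) h t * ((sech (b * t) : ℝ) : ℂ)

theorem memLp_adjointFunction {b : ℝ} (c : ℝ) (hb : 0 < b) (h : L2Interval) :
    MemLp (adjointFunction b c h) 2 (coshMeasure b) := by
  have hm : Continuous fun t : ℝ => ((sech (b * t) : ℝ) : ℂ) :=
    Complex.continuous_ofReal.comp (continuous_sech.comp (by fun_prop))
  refine (memLp_sech hb).of_le_mul (c := 1 * ∫ t, ‖h t‖ ∂intervalMeasure)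
    ((continuous_kernelIntegral (continuous_fourierKernel (-c)) (norm_fourierKernel_le (-c))
      (integrable_of_L2Interval h)).mul hm).aestronglyMeasurable
    (Eventually.of_forall fun t => ?_)
  rw [adjointFunction, norm_mul]
  exact mul_le_mul_of_nonneg_right (norm_kernelIntegral_le (norm_fourierKernel_le (-c))
    (integrable_of_L2Interval h) t) (norm_nonneg _)

theorem cosh_mul_sech (x : ℝ) : Real.cosh x * sech x = 1 := by
  unfold sech
  field_simp [(Real.cosh_pos x).ne']

theorem conj_kernelIntegral_fourierKernel (c : ℝ) (h : ℝ → ℂ) (t : ℝ) :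
    conj (kernelIntegral intervalMeasure (fourierKernel (-c)) h t) =
      kernelIntegral intervalMeasure (fun t x => fourierKernel c x t) (fun y => conj (h y)) t := by
  rw [kernelIntegral, kernelIntegral, ← integral_conj]
  congr 1
  funext y
  rw [map_mul]
  congr 1
  unfold fourierKernel
  rw [← Complex.exp_conj, map_mul, Complex.conj_I, Complex.conj_ofReal]
  congr 1
  push_cast
  ring

/-- The factor sech(bt) cancels the weight of the inner product; what remains is Fubini and
conjugation of the kernel. -/
theorem adjoint_truncatedFourier {b : ℝ} (c : ℝ) (hb : 0 < b) (h : L2Interval) :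
    ContinuousLinearMap.adjoint (truncatedFourier b c hb) h =
      (memLp_adjointFunction c hb h).toLp _ := by
  refine ext_inner_right ℂ fun f => ?_
  have hconj : Integrable (fun y => conj (h y)) intervalMeasure :=
    (Complex.conjLIE.toContinuousLinearEquiv.toContinuousLinearMap).integrable_comp
      (integrable_of_L2Interval h)
  rw [ContinuousLinearMap.adjoint_inner_left, L2.inner_def, L2.inner_def]
  have h1 : ∫ y, ⟪h y, truncatedFourier b c hb f y⟫_ℂ ∂intervalMeasure =
      ∫ y, kernelIntegral volume (fourierKernel c) f y * conj (h y) ∂intervalMeasure := by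
    refine integral_congr_ae ?_
    filter_upwards [truncatedFourier_coeFn (c := c) hb f] with y hy
    rw [hy, RCLike.inner_apply]
  have h2 : ∫ t, ⟪(memLp_adjointFunction c hb h).toLp _ t, f t⟫_ℂ ∂(coshMeasure b) =
      ∫ t, f t * conj (adjointFunction b c h t) ∂(coshMeasure b) := by
    refine integral_congr_ae ?_
    filter_upwards [(memLp_adjointFunction c hb h).coeFn_toLp] with t ht
    rw [ht, RCLike.inner_apply]
  rw [h1, h2, integral_kernelIntegral_mul (continuous_fourierKernel c) (norm_fourierKernel_le c)
    (integrable_of_L2Cosh hb f) hconj, integral_coshMeasure_complex]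
  congr 1
  funext t
  have hcs : ((Real.cosh (b * t) : ℝ) : ℂ) * ((sech (b * t) : ℝ) : ℂ) = 1 := by
    rw [← Complex.ofReal_mul, cosh_mul_sech, Complex.ofReal_one]
  rw [adjointFunction, map_mul, Complex.conj_ofReal, conj_kernelIntegral_fourierKernel]
  linear_combination (-(f t) * kernelIntegral intervalMeasure (fun t x => fourierKernel c x t)
    (fun y => conj (h y)) t) * hcs

/-- The two exponentials combine to frequency c(x - y), which leaves the Fourier transform of
sech(bt). -/
theorem integral_fourierKernel_mul_sech {b : ℝ} (c : ℝ) (hb : 0 < b) (x y : ℝ) :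
    (c : ℂ) * ∫ t, fourierKernel (-c) t y * (fourierKernel c x t * ((sech (b * t) : ℝ) : ℂ)) =
      convolutionKernel (c / b) x y := by
  have h1 : ∀ t : ℝ, fourierKernel (-c) t y * (fourierKernel c x t * ((sech (b * t) : ℝ) : ℂ)) =
      Complex.exp (Complex.I * (((c * (x - y)) * t : ℝ) : ℂ)) * ((sech (b * t) : ℝ) : ℂ) := by
    intro t
    unfold fourierKernel
    rw [← mul_assoc, ← Complex.exp_add]
    congr 2
    push_cast
    ring
  simp only [h1]
  rw [integral_exp_mul_sech hb, ← Complex.ofReal_mul, convolutionKernel]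
  congr 1
  rw [show Real.pi * (c / b) / 2 * (x - y) = Real.pi * (c * (x - y)) / (2 * b) by field_simp]
  ring

/-- The identity `c 𝓕 𝓕^* = 𝓠_{c/b}`. -/
theorem finiteConvolution_eq {b : ℝ} (c : ℝ) (hb : 0 < b) (h : L2Interval) :
    finiteConvolution (c / b) h = (c : ℂ) •
      truncatedFourier b c hb (ContinuousLinearMap.adjoint (truncatedFourier b c hb) h) := by
  refine Lp.ext ?_
  filter_upwards [finiteConvolution_coeFn (c / b) h, Lp.coeFn_smul (c : ℂ) (truncatedFourier b c hb
      (ContinuousLinearMap.adjoint (truncatedFourier b c hb) h)),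
    truncatedFourier_coeFn (c := c) hb (ContinuousLinearMap.adjoint (truncatedFourier b c hb) h)]
    with x h1 h2 h3
  rw [h1, h2, Pi.smul_apply, h3, smul_eq_mul]
  have hae : (ContinuousLinearMap.adjoint (truncatedFourier b c hb) h : L2Cosh b) =ᵐ[volume]
      adjointFunction b c h := by
    rw [adjoint_truncatedFourier]
    exact (volume_absolutelyContinuous b).ae_le (memLp_adjointFunction c hb h).coeFn_toLp
  have hs : Integrable (fun t : ℝ => fourierKernel c x t * ((sech (b * t) : ℝ) : ℂ)) :=
    integrable_kernel (continuous_fourierKernel c) (norm_fourierKernel_le c)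
      (integrable_sech_mul hb).ofReal x
  have h4 : kernelIntegral volume (fourierKernel c)
      (ContinuousLinearMap.adjoint (truncatedFourier b c hb) h : L2Cosh b) x =
      ∫ t, kernelIntegral intervalMeasure (fourierKernel (-c)) h t *
        (fourierKernel c x t * ((sech (b * t) : ℝ) : ℂ)) := by
    refine integral_congr_ae ?_
    filter_upwards [hae] with t ht
    rw [ht, adjointFunction]
    ring
  rw [h4, integral_kernelIntegral_mul (continuous_fourierKernel (-c)) (norm_fourierKernel_le (-c))
    (integrable_of_L2Interval h) hs, ← integral_const_mul, kernelIntegral]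
  congr 1
  funext y
  rw [← integral_fourierKernel_mul_sech c hb, kernelIntegral]
  ring

/-- The quadratic form of Q is c‖F* h‖², the source of its symmetry, its nonnegativity and the
inclusion of its kernel in that of F*. -/
theorem inner_finiteConvolution {b : ℝ} (c : ℝ) (hb : 0 < b) (h k : L2Interval) :
    ⟪h, finiteConvolution (c / b) k⟫_ℂ = c *
      ⟪ContinuousLinearMap.adjoint (truncatedFourier b c hb) h,
        ContinuousLinearMap.adjoint (truncatedFourier b c hb) k⟫_ℂ := by
  rw [finiteConvolution_eq c hb, inner_smul_right, ContinuousLinearMap.adjoint_inner_left]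

theorem isSymmetric_finiteConvolution {b : ℝ} (c : ℝ) (hb : 0 < b) :
    (finiteConvolution (c / b)).IsSymmetric := by
  intro h k
  rw [ContinuousLinearMap.coe_coe, ← inner_conj_symm, inner_finiteConvolution c hb,
    inner_finiteConvolution c hb, map_mul, inner_conj_symm, Complex.conj_ofReal]

theorem re_inner_finiteConvolution_nonneg {b c : ℝ} (hb : 0 < b) (hc : 0 < c) (h : L2Interval) :
    0 ≤ RCLike.re ⟪h, finiteConvolution (c / b) h⟫_ℂ := by
  rw [inner_finiteConvolution c hb, inner_self_eq_norm_sq_to_K]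
  have : (c : ℂ) * ((‖ContinuousLinearMap.adjoint (truncatedFourier b c hb) h‖ : ℝ) : ℂ) ^ 2 =
      ((c * ‖ContinuousLinearMap.adjoint (truncatedFourier b c hb) h‖ ^ 2 : ℝ) : ℂ) := by
    push_cast; rfl
  refine le_of_le_of_eq ?_ (congrArg Complex.re this.symm)
  rw [Complex.ofReal_re]
  positivity

theorem adjoint_eq_zero_of_finiteConvolution_eq_zero {b c : ℝ} (hb : 0 < b) (hc : 0 < c)
    {h : L2Interval} (hh : finiteConvolution (c / b) h = 0) :
    ContinuousLinearMap.adjoint (truncatedFourier b c hb) h = 0 := by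
  have h1 := inner_finiteConvolution c hb h h
  rw [hh, inner_zero_right] at h1
  exact inner_self_eq_zero.1 ((mul_eq_zero.1 h1.symm).resolve_left (by exact_mod_cast hc.ne'))

/-- Let V be the range of F*. F is injective and maps V into the range of Q, so finite rank of Q
would make V finite-dimensional. But the orthogonal complement of V is the kernel of F, which is
zero; then V would be the whole infinite-dimensional space. -/
theorem not_finiteDimensional_range_finiteConvolution {b c : ℝ} (hb : 0 < b) (hc : 0 < c) :
    ¬ FiniteDimensional ℂ
      (LinearMap.range (finiteConvolution (c / b) : L2Interval →ₗ[ℂ] L2Interval)) := by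
  intro hfd
  set F := truncatedFourier b c hb with hF
  set V := LinearMap.range (ContinuousLinearMap.adjoint F : L2Interval →ₗ[ℂ] L2Cosh b) with hV
  have hinj : Function.Injective ((F : L2Cosh b →ₗ[ℂ] L2Interval).comp V.subtype) :=
    (injective_truncatedFourier hb hc).comp Subtype.val_injective
  have hle : LinearMap.range ((F : L2Cosh b →ₗ[ℂ] L2Interval).comp V.subtype) ≤
      LinearMap.range (finiteConvolution (c / b) : L2Interval →ₗ[ℂ] L2Interval) := by
    rintro _ ⟨⟨_, h, rfl⟩, rfl⟩
    refine ⟨(c : ℂ)⁻¹ • h, ?_⟩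
    rw [map_smul, ContinuousLinearMap.coe_coe, finiteConvolution_eq c hb, smul_smul,
      inv_mul_cancel₀ (by exact_mod_cast hc.ne'), one_smul]
    rfl
  have := Submodule.finiteDimensional_of_le hle
  have hVfd : FiniteDimensional ℂ V :=
    LinearEquiv.finiteDimensional (LinearEquiv.ofInjective _ hinj).symm
  have hbot : Vᗮ = ⊥ := by
    rw [Submodule.eq_bot_iff]
    intro f hf
    refine injective_truncatedFourier hb hc ?_
    rw [map_zero]
    refine ext_inner_left ℂ fun h => ?_
    rw [inner_zero_right, ← ContinuousLinearMap.adjoint_inner_left]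
    exact (Submodule.mem_orthogonal V f).1 hf _ ⟨h, rfl⟩
  -- Finite dimension of V is what turns density into equality.
  have htop : V = ⊤ := (Submodule.orthogonal_eq_bot_iff).1 hbot
  rw [htop] at hVfd
  exact not_finiteDimensional_L2Cosh b (LinearEquiv.finiteDimensional (Submodule.topEquiv (R := ℂ)
    (M := L2Cosh b)))

theorem exists_isEigensystem {b c : ℝ} (hb : 0 < b) (hc : 0 < c) :
    ∃ (ρ : ℕ → ℝ) (g : ℕ → L2Interval), IsEigensystem (c / b) ρ g := by
  obtain ⟨ρ, g, h1, h2, h3, h4, h5⟩ := CompactSpectral.exists_eigenvalue_enumeration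
    (isCompactOperator_finiteConvolution (c / b)) (isSymmetric_finiteConvolution c hb)
    (re_inner_finiteConvolution_nonneg hb hc) (not_finiteDimensional_range_finiteConvolution hb hc)
  refine ⟨ρ, g, h1, h2, fun r hr => ?_, h4, h5⟩
  have := ContinuousLinearMap.finite_dimensional_eigenspace
    (isCompactOperator_finiteConvolution (c / b)) (r : ℂ) (by exact_mod_cast hr.ne')
  rw [h3 r hr, Module.finrank_eq_rank]

section Eigensystem

variable {b c : ℝ} {ρ : ℕ → ℝ} {g : ℕ → L2Interval}

theorem singularValue_pos (hc : 0 < c) (hρ : ∀ m, 0 < ρ m) (m : ℕ) : 0 < singularValue c ρ m :=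
  Real.sqrt_pos.2 (div_pos (hρ m) hc)

theorem IsEigensystem.truncatedFourier_adjoint (hb : 0 < b) (hc : 0 < c)
    (h : IsEigensystem (c / b) ρ g) (m : ℕ) :
    truncatedFourier b c hb (ContinuousLinearMap.adjoint (truncatedFourier b c hb) (g m)) =
      ((singularValue c ρ m : ℂ) ^ 2) • g m := by
  have h1 := h.eigen m
  rw [finiteConvolution_eq c hb] at h1
  have hc' : (c : ℂ) ≠ 0 := by exact_mod_cast hc.ne'
  rw [← Complex.ofReal_pow, singularValue, Real.sq_sqrt (div_pos (h.pos m) hc).le,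
    ← inv_smul_smul₀ hc' (truncatedFourier b c hb _), h1, smul_smul]
  congr 1
  push_cast
  field_simp

theorem IsEigensystem.truncatedFourier_singularVector (hb : 0 < b) (hc : 0 < c)
    (h : IsEigensystem (c / b) ρ g) (m : ℕ) :
    truncatedFourier b c hb (singularVector b c hb ρ g m) = (singularValue c ρ m : ℂ) • g m := by
  have hσ : (singularValue c ρ m : ℂ) ≠ 0 := by exact_mod_cast (singularValue_pos hc h.pos m).ne'
  rw [singularVector, map_smul, h.truncatedFourier_adjoint hb hc, smul_smul, sq,
    inv_mul_cancel_left₀ hσ]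

theorem inner_singularVector (hb : 0 < b) (m : ℕ) (f : L2Cosh b) :
    ⟪singularVector b c hb ρ g m, f⟫_ℂ =
      (singularValue c ρ m : ℂ)⁻¹ * ⟪g m, truncatedFourier b c hb f⟫_ℂ := by
  rw [singularVector, inner_smul_left, ContinuousLinearMap.adjoint_inner_left, map_inv₀,
    Complex.conj_ofReal]

theorem IsEigensystem.orthonormal_singularVector (hb : 0 < b) (hc : 0 < c)
    (h : IsEigensystem (c / b) ρ g) : Orthonormal ℂ (singularVector b c hb ρ g) := by
  rw [orthonormal_iff_ite]
  intro m n
  rw [inner_singularVector, h.truncatedFourier_singularVector hb hc, inner_smul_right,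
    orthonormal_iff_ite.1 h.orthonormal]
  have hσ : (singularValue c ρ m : ℂ) ≠ 0 := by exact_mod_cast (singularValue_pos hc h.pos m).ne'
  split_ifs with hmn
  · subst hmn
    rw [mul_one, inv_mul_cancel₀ hσ]
  · simp

/-- Completeness of g in L²(-1, 1) is not needed: F f orthogonal to all g m gives Q F f = 0, hence
F* F f = 0, and ‖F f‖² = ⟪F* F f, f⟫ = 0. -/
theorem IsEigensystem.orthogonal_span_singularVector (hb : 0 < b) (hc : 0 < c)
    (h : IsEigensystem (c / b) ρ g) :
    (Submodule.span ℂ (Set.range (singularVector b c hb ρ g)))ᗮ = ⊥ := by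
  rw [Submodule.eq_bot_iff]
  intro f hf
  have hg : ∀ m, ⟪g m, truncatedFourier b c hb f⟫_ℂ = 0 := by
    intro m
    have h1 := (Submodule.mem_orthogonal _ f).1 hf _ (Submodule.subset_span ⟨m, rfl⟩)
    rw [inner_singularVector] at h1
    refine (mul_eq_zero.1 h1).resolve_left (inv_ne_zero ?_)
    exact_mod_cast (singularValue_pos hc h.pos m).ne'
  have h2 := adjoint_eq_zero_of_finiteConvolution_eq_zero hb hc
    (CompactSpectral.apply_eq_zero_of_orthogonal_enumeration
      (isCompactOperator_finiteConvolution (c / b)) (isSymmetric_finiteConvolution c hb)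
      (re_inner_finiteConvolution_nonneg hb hc)
      (fun r hr => by
        -- `Nat.card` and `finrank` are by definition the `toNat` of the two cardinals.
        have := congrArg Cardinal.toNat (h.multiplicity r hr)
        exact this) h.orthonormal h.eigen hg)
  have h3 : truncatedFourier b c hb f = 0 := by
    rw [← inner_self_eq_zero (𝕜 := ℂ), ← ContinuousLinearMap.adjoint_inner_left, h2,
      inner_zero_left]
  exact injective_truncatedFourier hb hc (h3.trans (map_zero _).symm)

end Eigensystem

end WeightedFourier

end

theorem proposition2p2 (b c : ℝ) (hb : 0 < b) (hc : 0 < c) :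
    Function.Injective (WeightedFourier.truncatedFourier b c hb) ∧
    (∃ (ρ : ℕ → ℝ) (g : ℕ → WeightedFourier.L2Interval),
      WeightedFourier.IsEigensystem (c / b) ρ g) ∧
    ∀ (ρ : ℕ → ℝ) (g : ℕ → WeightedFourier.L2Interval),
      WeightedFourier.IsEigensystem (c / b) ρ g →
        (∀ m, WeightedFourier.truncatedFourier b c hb
            (WeightedFourier.singularVector b c hb ρ g m) =
          (WeightedFourier.singularValue c ρ m : ℂ) • g m) ∧
        ∃ B : HilbertBasis ℕ ℂ (WeightedFourier.L2Cosh b),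
          ∀ m, B m = WeightedFourier.singularVector b c hb ρ g m := by
  refine ⟨WeightedFourier.injective_truncatedFourier hb hc,
    WeightedFourier.exists_isEigensystem hb hc, fun ρ g h =>
    ⟨h.truncatedFourier_singularVector hb hc,
      HilbertBasis.mkOfOrthogonalEqBot (h.orthonormal_singularVector hb hc)
        (h.orthogonal_span_singularVector hb hc), fun m => ?_⟩⟩
  rw [HilbertBasis.coe_mkOfOrthogonalEqBot]
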